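/- **Conventions.** A quantum system is the algebra $\mathcal L(H)$ of operators on a nonzero finite-dimensional complex Hilbert space $H$. A channel is a completely positive trace-preserving linear map between quantum systems; it is unitary if it is a $*$-isomorphism. For finite sets $A$, $B$ of labels and systems $\mathbf A_a$ ($a\in A$), $\mathbf B_b$ ($b\in B$), write $\mathbf A_A=\bigotimes_a\mathbf A_a$ and $\mathbf B_B=\bigotimes_b\mathbf B_b$. The causal structure of a unitary channel $\mathcal U:\mathbf A_A\to\mathbf B_B$ is the relation $G_{\mathcal U}\subseteq A\times B$ such that $(a,b)\notin G_{\mathcal U}$ if and only if $\mathcal U^\dagger(\mathbf B_b)\subseteq \mathbf A_a'$, where $\mathcal U^\dagger$ is the Hilbert-Schmidt adjoint, $\mathbf A_a$ and $\mathbf B_b$ are regarded as subalgebras of $\mathbf A_A$ and $\mathbf B_B$, and $'$ is the commutant. A quantum circuit with these inputs and outputs consists of a finite partially ordered set $\mathtt C$ of boxes, maps $\lambda:A\to \mathtt C$ and $\mu:B\to \mathtt C$, a quantum system $\mathbf Z_p^q$ for every covering pair $p\lessdot q$ in $\mathtt C$, and for every $p\in \mathtt C$ a channel (gate) $$\mathcal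 E_p:\ \bigotimes_{a\in\lambda^{-1}(p)}\mathbf A_a\otimes\bigotimes_{q\lessdot p}\mathbf Z_q^p\ \longrightarrow\ \bigotimes_{r\gtrdot p}\mathbf Z_p^r\otimes\bigotimes_{b\in\mu^{-1}(p)}\mathbf B_b .$$ It is a circuit decomposition of $\mathcal U:\mathbf A_A\to\mathbf B_B$ if composing all gates along the systems $\mathbf Z_p^q$ gives $\mathcal U$. It is unitary if all its gates are unitary channels. Its connectivity is the relation $\{(a,b)\in A\times B:\lambda(a)\le\mu(b)\}$. Let $C_3=\{1,2,3\}^2\setminus\{(1,3),(3,1)\}$, and let $\mathcal U_3$ be the three-qubit unitary channel $\rho\mapsto W\rho W^*$ with $W|x,y,z\rangle=|x\oplus y,\,y,\,z\oplus y\rangle$, i.e. two CNOT gates controlled on the second qubit with the first and the third qubit as targets. **Proposition.** Let $A$, $B$ be finite sets, and let $G\subseteq A\times B$ restrict to $C_3$ on some inputs $a_1,a_2,a_3\in A$ and outputs $b_1,b_2,b_3\in B$; that is, $(a_i,b_j)\in G$ if and only if $(i,j)\in C_3$. Let $\mathcal V:\mathbf A_A\to\mathbf B_B$ be a unitary channel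 between quantum systems $(\mathbf A_a)_{a\in A}$ and $(\mathbf B_b)_{b\in B}$ with $G_{\mathcal V}=G$. Let $\mathcal U=\mathcal U_3\otimes\mathcal V$, regarded as a channel with inputs labelled by $A$ and outputs labelled by $B$, by grouping the $i$-th input qubit of $\mathcal U_3$ with $\mathbf A_{a_i}$ and the $i$-th output qubit of $\mathcal U_3$ with $\mathbf B_{b_i}$ for $i=1,2,3$. Then $\mathcal U$ is a unitary channel with causal structure $G_{\mathcal U}=G$, but $\mathcal U$ has no unitary circuit decomposition with connectivity $G$. -/

import Mathlib

/-! ### Quantum systems and channels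

A quantum system is the full operator algebra `L(H)` of a finite-dimensional, nonzero Hilbert space
`H`. It is presented by the (finite, nonempty) index type `ι` of an orthonormal basis of `H`, so that
`L(H)` is the matrix algebra over `ι`. A composite of systems has as its basis the product of the
bases; in particular a family `H : L → Type` of systems has the composite `∀ x, H x`. -/

/-- The operator algebra of the quantum system with orthonormal basis `ι`. -/
abbrev Op (ι : Type*) := Matrix ι ι ℂ

section Channels

variable {ι κ ι' κ' : Type*} [Fintype κ] [DecidableEq κ] [Fintype κ'] [DecidableEq κ']

/-- The matrix entries of a linear map between operator algebras:
`coeff E i i' j j' = ⟨i| E(|j⟩⟨j'|) |i'⟩`. -/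
def coeff (E : Op κ →ₗ[ℂ] Op ι) (i i' : ι) (j j' : κ) : ℂ :=
  E (Matrix.single j j' 1) i i'

/-- The linear map between operator algebras that has given matrix entries. -/
def ofCoeff (c : ι → ι → κ → κ → ℂ) : Op κ →ₗ[ℂ] Op ι where
  toFun ρ := Matrix.of fun i i' => ∑ j, ∑ j', c i i' j j' * ρ j j'
  map_add' ρ σ := by
    ext i i'
    simp [mul_add, Finset.sum_add_distrib]
  map_smul' r ρ := by
    ext i i'
    simp [Finset.mul_sum, mul_left_comm]

/-- `ofCoeff c` has the matrix entries `c`. -/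
theorem coeff_ofCoeff (c : ι → ι → κ → κ → ℂ) : coeff (ofCoeff c) = c := by
  funext i i' j j'
  change ∑ k, ∑ k', c i i' k k' * Matrix.single j j' (1 : ℂ) k k' = c i i' j j'
  rw [Finset.sum_eq_single j, Finset.sum_eq_single j']
  · simp
  · intro k' _ hk
    simp [hk.symm]
  · simp
  · intro k _ hk
    simp [hk.symm]
  · simp

/-- Every linear map is recovered from its matrix entries. -/
theorem ofCoeff_coeff (E : Op κ →ₗ[ℂ] Op ι) : ofCoeff (coeff E) = E := by
  refine LinearMap.ext fun ρ => Matrix.ext fun i i' => ?_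
  conv_rhs => rw [Matrix.matrix_eq_sum_single ρ]
  simp only [map_sum, Matrix.sum_apply]
  refine Finset.sum_congr rfl fun j _ => Finset.sum_congr rfl fun j' _ => ?_
  have h : Matrix.single j j' (ρ j j') = ρ j j' • Matrix.single j j' (1 : ℂ) := by simp
  rw [h, map_smul, Matrix.smul_apply, smul_eq_mul, mul_comm, coeff]

/-- The linear map `id ⊗ E`, with an `n`-dimensional ancilla. -/
def ampliation (n : ℕ) (E : Op κ →ₗ[ℂ] Op ι) (ρ : Op (Fin n × κ)) : Op (Fin n × ι) :=
  Matrix.of fun x y => E (Matrix.of fun j j' => ρ (x.1, j) (y.1, j')) x.2 y.2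

open scoped ComplexOrder in
/-- Quantum channels: completely positive and trace-preserving linear maps. -/
def IsCPTP [Fintype ι] (E : Op κ →ₗ[ℂ] Op ι) : Prop :=
  (∀ (n : ℕ) (ρ : Op (Fin n × κ)), ρ.PosSemidef → (ampliation n E ρ).PosSemidef) ∧
    ∀ ρ : Op κ, (E ρ).trace = ρ.trace

/-- Unitary channels: the `*`-isomorphisms between the operator algebras. -/
def IsUnitaryChannel [Fintype ι] (E : Op κ →ₗ[ℂ] Op ι) : Prop :=
  ∃ φ : Op κ ≃⋆ₐ[ℂ] Op ι, ∀ ρ, E ρ = φ ρ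

/-- The adjoint of `E` for the Hilbert-Schmidt inner product `⟨X, Y⟩ = Tr (X* Y)`. -/
def hsAdjoint [Fintype ι] (E : Op κ →ₗ[ℂ] Op ι) (Y : Op ι) : Op κ :=
  Matrix.of fun j j' => ((E (Matrix.single j j' 1)).conjTranspose * Y).trace

/-- The defining property of the Hilbert-Schmidt adjoint. -/
theorem trace_hsAdjoint [Fintype ι] (E : Op κ →ₗ[ℂ] Op ι) (X : Op κ) (Y : Op ι) :
    (X.conjTranspose * hsAdjoint E Y).trace = ((E X).conjTranspose * Y).trace := by
  conv_rhs => rw [Matrix.matrix_eq_sum_single X]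
  simp only [map_sum, Matrix.conjTranspose_sum, Finset.sum_mul, Matrix.trace_sum]
  simp only [Matrix.trace, Matrix.diag_apply, Matrix.mul_apply, Matrix.conjTranspose_apply]
  rw [Finset.sum_comm]
  refine Finset.sum_congr rfl fun j _ => Finset.sum_congr rfl fun j' _ => ?_
  have h : Matrix.single j j' (X j j') = X j j' • Matrix.single j j' (1 : ℂ) := by simp
  rw [h, map_smul]
  simp [hsAdjoint, Matrix.trace, Matrix.mul_apply, Finset.mul_sum, mul_assoc]

/-- The tensor product of two linear maps between operator algebras. -/
def tensorMap (E : Op κ →ₗ[ℂ] Op ι) (F : Op κ' →ₗ[ℂ] Op ι') : Op (κ × κ') →ₗ[ℂ] Op (ι × ι') :=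
  ofCoeff fun i i' j j' => coeff E i.1 i'.1 j.1 j'.1 * coeff F i.2 i'.2 j.2 j'.2

end Channels

/-! ### Causal structure -/

section Causal

variable {L : Type*} {H : L → Type*}

open Classical in
/-- The operator `m ⊗ 1` on the composite of all systems, for an operator `m` on the composite of
the systems with labels in `S`. -/
noncomputable def embedOp (S : Set L) (m : Op (∀ x : S, H x)) : Op (∀ x, H x) :=
  Matrix.of fun i j =>
    if ∀ x, x ∉ S → i x = j x then m (fun x => i x) (fun x => j x) else 0

/-- The subalgebra of the operators on the composite system that act on the labels in `S` only. -/
def localOps (H : L → Type*) (S : Set L) : Set (Op (∀ x, H x)) :=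
  Set.range (embedOp (H := H) S)

variable {A B : Type*} [Fintype A] [DecidableEq A] [Fintype B] [DecidableEq B]
  {HA : A → Type*} {HB : B → Type*}
  [∀ x, Fintype (HA x)] [∀ x, DecidableEq (HA x)] [∀ y, Fintype (HB y)] [∀ y, DecidableEq (HB y)]

/-- The inputs in `S` do not influence the outputs in `T` through `U`: the adjoint of `U` sends every
operator on the outputs in `T` into the commutant of the operators on the inputs in `S`. -/
def NoInfluence (U : Op (∀ x, HA x) →ₗ[ℂ] Op (∀ y, HB y)) (S : Set A) (T : Set B) : Prop :=
  hsAdjoint U '' localOps HB T ⊆ Set.centralizer (localOps HA S)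

/-- The causal structure of `U`: the relation of influence between single inputs and outputs. -/
def causalStructure (U : Op (∀ x, HA x) →ₗ[ℂ] Op (∀ y, HB y)) : A → B → Prop :=
  fun x y => ¬ NoInfluence U {x} {y}

end Causal

/-! ### Quantum circuits -/

/-- A circuit shape: a finite partially ordered set of boxes, to which the inputs and the outputs
are attached. -/
structure CircuitShape (A B : Type*) where
  Box : Type
  [fintypeBox : Fintype Box]
  [decEqBox : DecidableEq Box]
  [orderBox : PartialOrder Box]
  lam : A → Box
  mu : B → Box

attribute [instance] CircuitShape.fintypeBox CircuitShape.decEqBox CircuitShape.orderBox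

namespace CircuitShape

variable {A B : Type*}

/-- There is a path from the input `x` to the output `y`. -/
def connectivity (S : CircuitShape A B) : A → B → Prop := fun x y => S.lam x ≤ S.mu y

/-- The internal wires: the edges `p ⋖ q` of the Hasse diagram. -/
structure Wire (S : CircuitShape A B) where
  src : S.Box
  tgt : S.Box
  covBy : src ⋖ tgt

theorem Wire.pair_injective (S : CircuitShape A B) :
    Function.Injective fun e : S.Wire => (e.src, e.tgt) := by
  rintro ⟨p, q, h⟩ ⟨p', q', h'⟩ hpq
  simp only [Prod.mk.injEq] at hpq
  obtain ⟨rfl, rfl⟩ := hpq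
  rfl

instance (S : CircuitShape A B) : DecidableEq S.Wire :=
  (Wire.pair_injective S).decidableEq

noncomputable instance (S : CircuitShape A B) : Fintype S.Wire :=
  Fintype.ofInjective _ (Wire.pair_injective S)

/-- The basis of the input system of the box `p`: the inputs attached to `p`, together with the
systems `Z` on the wires that end in `p`. -/
abbrev GateIn (S : CircuitShape A B) (HA : A → Type*) (Z : S.Wire → Type) (p : S.Box) :=
  (∀ x : {x // S.lam x = p}, HA x) × (∀ e : {e : S.Wire // e.tgt = p}, Z e)

/-- The basis of the output system of the box `p`: the systems `Z` on the wires that start in `p`,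
together with the outputs attached to `p`. -/
abbrev GateOut (S : CircuitShape A B) (HB : B → Type*) (Z : S.Wire → Type) (p : S.Box) :=
  (∀ e : {e : S.Wire // e.src = p}, Z e) × (∀ y : {y // S.mu y = p}, HB y)

/-- The part of the labels of the input basis and of the wire bases that is seen by the box `p`
as its input. -/
def inAt (S : CircuitShape A B) {HA : A → Type*} {Z : S.Wire → Type} (x : ∀ a, HA a)
    (z : ∀ e, Z e) (p : S.Box) : S.GateIn HA Z p :=
  (fun a => x a, fun e => z e)

/-- The part of the labels of the wire bases and of the output basis that is seen by the box `p`
as its output. -/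
def outAt (S : CircuitShape A B) {HB : B → Type*} {Z : S.Wire → Type} (z : ∀ e, Z e)
    (y : ∀ b, HB b) (p : S.Box) : S.GateOut HB Z p :=
  (fun e => z e, fun b => y b)

end CircuitShape

/-- A quantum circuit with inputs `HA` and outputs `HB`: a circuit shape with a quantum system on each
internal wire and a channel in each box. -/
structure QuantumCircuit {A B : Type*} [Fintype A] [DecidableEq A] [Fintype B] [DecidableEq B]
    (HA : A → Type*) (HB : B → Type*) [∀ x, Fintype (HA x)] [∀ x, DecidableEq (HA x)]
    [∀ y, Fintype (HB y)] [∀ y, DecidableEq (HB y)] extends CircuitShape A B where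
  Z : toCircuitShape.Wire → Type
  [fintypeZ : ∀ e, Fintype (Z e)]
  [decEqZ : ∀ e, DecidableEq (Z e)]
  [nonemptyZ : ∀ e, Nonempty (Z e)]
  gate : ∀ p, Op (toCircuitShape.GateIn HA Z p) →ₗ[ℂ] Op (toCircuitShape.GateOut HB Z p)
  gate_isCPTP : ∀ p, IsCPTP (gate p)

attribute [instance] QuantumCircuit.fintypeZ QuantumCircuit.decEqZ QuantumCircuit.nonemptyZ

namespace QuantumCircuit

variable {A B : Type*} [Fintype A] [DecidableEq A] [Fintype B] [DecidableEq B]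
    {HA : A → Type*} {HB : B → Type*} [∀ x, Fintype (HA x)] [∀ x, DecidableEq (HA x)]
    [∀ y, Fintype (HB y)] [∀ y, DecidableEq (HB y)]

/-- The map that a circuit composes to: the gates are multiplied together and contracted along the
internal wires, each of which is an output of exactly one gate and an input of exactly one gate. -/
noncomputable def channel (C : QuantumCircuit HA HB) : Op (∀ x, HA x) →ₗ[ℂ] Op (∀ y, HB y) :=
  ofCoeff fun y y' x x' =>
    ∑ z : ∀ e, C.Z e, ∑ z' : ∀ e, C.Z e, ∏ p : C.Box,
      coeff (C.gate p) (C.outAt z y p) (C.outAt z' y' p) (C.inAt x z p) (C.inAt x' z' p)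

/-- `C` is a circuit decomposition of `U`. -/
def IsDecompositionOf (C : QuantumCircuit HA HB) (U : Op (∀ x, HA x) →ₗ[ℂ] Op (∀ y, HB y)) : Prop :=
  C.channel = U

/-- Every gate of the circuit is a unitary channel. -/
def IsUnitary (C : QuantumCircuit HA HB) : Prop := ∀ p, IsUnitaryChannel (C.gate p)

end QuantumCircuit

/-! ### The relation `C₃`, the unitary `U₃`, and the unitary `U₃ ⊗ V` -/

/-- The relation `C₃` between three inputs and three outputs (numbered from `0`): all pairs but the
first input with the third output, and the third input with the first output. -/
def relC3 (i j : Fin 3) : Prop := ¬ (i = 0 ∧ j = 2) ∧ ¬ (i = 2 ∧ j = 0)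

/-- `G` restricts to `C₃` on the inputs `a 0`, `a 1`, `a 2` and the outputs `b 0`, `b 1`, `b 2`. (These
labels are then automatically distinct.) -/
def RestrictsToC3 {A B : Type*} (G : A → B → Prop) (a : Fin 3 → A) (b : Fin 3 → B) : Prop :=
  ∀ i j, G (a i) (b j) ↔ relC3 i j

/-- The CNOT gate on three qubits with control `c` and target `t`:
`|s⟩ ↦ |s with s t replaced by s t + s c mod 2⟩`. -/
def cnot (c t : Fin 3) : Op (Fin 3 → Fin 2) :=
  Matrix.of fun s' s => if s' = Function.update s t (s t + s c) then 1 else 0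

/-- The channel `ρ ↦ W ρ W*`. -/
def conjMap {ι : Type*} [Fintype ι] [DecidableEq ι] (W : Op ι) : Op ι →ₗ[ℂ] Op ι :=
  (LinearMap.mulLeft ℂ W).comp (LinearMap.mulRight ℂ W.conjTranspose)

/-- The three-qubit unitary channel `U₃` consisting of two CNOT gates, both controlled on the middle
qubit, with the first and the third qubit as their targets. -/
def U3 : Op (Fin 3 → Fin 2) →ₗ[ℂ] Op (Fin 3 → Fin 2) :=
  conjMap (cnot 1 0 * cnot 1 2)

section WithQubits

variable {L : Type*} (e : Fin 3 → L)

/-- For injective `e`, a single qubit when `x` is one of `e 0`, `e 1`, `e 2`, and the trivial system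
otherwise. -/
abbrev QubitAt [DecidableEq L] (x : L) : Type := {i : Fin 3 // e i = x} → Fin 2

/-- The family of systems `H`, with an additional qubit at the labels `e 0`, `e 1`, `e 2`. -/
abbrev WithQubits [DecidableEq L] (H : L → Type*) (x : L) := QubitAt e x × H x

/-- The composite of the systems with additional qubits is the composite of the three qubits and of
the original systems. -/
def splitQubits [DecidableEq L] (H : L → Type*) :
    (∀ x, WithQubits e H x) ≃ (Fin 3 → Fin 2) × (∀ x, H x) where
  toFun k := (fun i => (k (e i)).1 ⟨i, rfl⟩, fun x => (k x).2)
  invFun k := fun x => (fun i => k.1 i, k.2 x)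
  left_inv k := by
    funext x
    refine Prod.ext (funext fun i => ?_) rfl
    obtain ⟨i, rfl⟩ := i
    rfl
  right_inv _ := rfl

end WithQubits

/-- The channel `U₃ ⊗ V`, regarded as a channel whose inputs and outputs have the same labels as those
of `V`: the three input qubits of `U₃` are grouped with the inputs `a 0`, `a 1`, `a 2` of `V`, and the
three output qubits with the outputs `b 0`, `b 1`, `b 2`. -/
def tensorU3 {A B : Type*} [Fintype A] [DecidableEq A] [Fintype B] [DecidableEq B]
    {HA : A → Type*} {HB : B → Type*} [∀ x, Fintype (HA x)] [∀ x, DecidableEq (HA x)]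
    [∀ y, Fintype (HB y)] [∀ y, DecidableEq (HB y)] (a : Fin 3 → A) (b : Fin 3 → B)
    (V : Op (∀ x, HA x) →ₗ[ℂ] Op (∀ y, HB y)) :
    Op (∀ x, WithQubits a HA x) →ₗ[ℂ] Op (∀ y, WithQubits b HB y) :=
  (Matrix.reindexLinearEquiv ℂ ℂ (splitQubits b HB).symm (splitQubits b HB).symm).toLinearMap ∘ₗ
    tensorMap U3 V ∘ₗ
      (Matrix.reindexLinearEquiv ℂ ℂ (splitQubits a HA) (splitQubits a HA)).toLinearMap

/-! The channel `U₃ ⊗ V` is conjugation by a unitary `K`, the tensor product of the permutation matrix of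
the two CNOT gates with a unitary matrix of `V`. This yields unitarity at once. The causal structure of
`U₃` is contained in `C₃`, hence, at the labels `a i`, `b j`, in that of `V`; and operators on a composite
of a qubit and another system are spanned by products, so the causal structure of `U₃ ⊗ V` is that of `V`.

For the impossibility, only two properties of `U₃ ⊗ V` matter. The Pauli observable `Z` of the qubit
at `b 0` is the image of the product of those at `a 0` and `a 1`, and likewise at `b 2` with `a 2` and
`a 1`. Given a circuit of unitary gates without paths from `a 0` to `b 2` and from `a 2` to `b 0`, let
`D₁`, `D₃` be the pasts of `b 0` and `b 2`. Then `a 0` enters the circuit in `D₁ \ D₃`, so `D₁ ∩ D₃`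
must carry the `Z` of `a 1` to an observable of the wires that lead into `D₁ \ D₃`; symmetrically, it
carries it to an observable of the wires that lead into `D₃ \ D₁`. These are different tensor factors, so
the observable is a scalar, but the gates are invertible and the Pauli operator `Z` is not a scalar
(`QuantumCircuit.constant_of_copied`).

In order that all observables live on one fixed space, a gate with unitary matrix `U` is replaced by the
unitary `(U* ⊗ U) ∘ SWAP` on the joint system of all wires of the circuit (`exchange`). The product of
these, in the order of the circuit, has as matrix entries the entries of the matrix of the circuit times
entries of the inverse gates (`exchange_prod_apply`), so it has the same diagonal observables as the
circuit. -/

open scoped Matrix Kronecker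

/-! ### Unitary channels as conjugations -/

/-- The map `ρ ↦ M ρ M*` for a rectangular matrix `M`. -/
def conjBy {ι κ : Type*} [Fintype κ] (M : Matrix ι κ ℂ) : Op κ →ₗ[ℂ] Op ι where
  toFun ρ := M * ρ * Mᴴ
  map_add' ρ σ := by rw [Matrix.mul_add, Matrix.add_mul]
  map_smul' r ρ := by simp

theorem conjBy_apply {ι κ : Type*} [Fintype κ] (M : Matrix ι κ ℂ) (ρ : Op κ) :
    conjBy M ρ = M * ρ * Mᴴ := rfl

theorem coeff_conjBy {ι κ : Type*} [Fintype κ] [DecidableEq κ] (M : Matrix ι κ ℂ)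
    (i i' : ι) (j j' : κ) : coeff (conjBy M) i i' j j' = M i j * star (M i' j') := by
  rw [coeff, conjBy_apply, Matrix.mul_apply, Finset.sum_eq_single j']
  · rw [Matrix.mul_apply, Finset.sum_eq_single j] <;> simp +contextual [Matrix.single_apply]
    intro b hb h; exact absurd h.symm hb
  · intro b _ hb
    rw [Matrix.mul_apply, Finset.sum_eq_zero]
    · simp
    · intro c _; simp [hb.symm]
  · simp

theorem hsAdjoint_conjBy {ι κ : Type*} [Fintype ι] [Fintype κ] [DecidableEq κ]
    (M : Matrix ι κ ℂ) (Y : Op ι) : hsAdjoint (conjBy M) Y = Mᴴ * Y * M := by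
  ext j j'
  have h : ((conjBy M (Matrix.single j j' 1))ᴴ * Y).trace
      = (Matrix.single j' j 1 * (Mᴴ * Y * M)).trace := by
    rw [conjBy_apply, Matrix.conjTranspose_mul, Matrix.conjTranspose_conjTranspose,
      Matrix.conjTranspose_mul, Matrix.conjTranspose_single, star_one, Matrix.mul_assoc,
      Matrix.mul_assoc, Matrix.trace_mul_comm]
    simp only [Matrix.mul_assoc]
  rw [hsAdjoint, Matrix.of_apply, h, Matrix.trace_single_mul]
  simp

theorem conjBy_submatrix {ι κ ι₁ κ₁ : Type*} [Fintype κ] [Fintype κ₁]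
    (M : Matrix ι κ ℂ) (e : ι₁ ≃ ι) (f : κ₁ ≃ κ) :
    (Matrix.reindexLinearEquiv ℂ ℂ e.symm e.symm).toLinearMap ∘ₗ conjBy M ∘ₗ
      (Matrix.reindexLinearEquiv ℂ ℂ f f).toLinearMap = conjBy (M.submatrix e f) := by
  refine LinearMap.ext fun ρ => ?_
  simp only [LinearMap.comp_apply, LinearEquiv.coe_coe, Matrix.coe_reindexLinearEquiv,
    Matrix.reindex_apply, conjBy_apply, Equiv.symm_symm, Matrix.conjTranspose_submatrix]
  rw [← Matrix.submatrix_mul_equiv _ _ _ f, ← Matrix.submatrix_mul_equiv _ _ _ f]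
  simp

section

variable {ι κ : Type*} [Fintype ι] [DecidableEq ι] [Fintype κ] [DecidableEq κ]

theorem isUnitaryChannel_conjBy {M : Matrix ι κ ℂ} (h₁ : Mᴴ * M = 1) (h₂ : M * Mᴴ = 1) :
    IsUnitaryChannel (conjBy M) := by
  refine ⟨{ toFun := fun ρ => M * ρ * Mᴴ
            invFun := fun σ => Mᴴ * σ * M
            left_inv := fun ρ => ?_
            right_inv := fun σ => ?_
            map_mul' := fun ρ σ => ?_
            map_add' := fun ρ σ => ?_
            map_star' := fun ρ => ?_
            map_smul' := fun r ρ => ?_ }, fun ρ => rfl⟩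
  · calc Mᴴ * (M * ρ * Mᴴ) * M = (Mᴴ * M) * ρ * (Mᴴ * M) := by simp only [Matrix.mul_assoc]
      _ = ρ := by simp [h₁]
  · calc M * (Mᴴ * σ * M) * Mᴴ = (M * Mᴴ) * σ * (M * Mᴴ) := by simp only [Matrix.mul_assoc]
      _ = σ := by simp [h₂]
  · calc M * (ρ * σ) * Mᴴ = M * ρ * (Mᴴ * M) * (σ * Mᴴ) := by
          rw [h₁, Matrix.mul_one]; simp only [Matrix.mul_assoc]
      _ = M * ρ * Mᴴ * (M * σ * Mᴴ) := by simp only [Matrix.mul_assoc]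
  · simp [Matrix.mul_add, Matrix.add_mul]
  · simp [Matrix.star_eq_conjTranspose, Matrix.mul_assoc]
  · simp

/-- Every `*`-isomorphism between full matrix algebras is conjugation by a unitary. The columns of the
unitary are the images `φ(|j⟩⟨j₀|) v` of a unit vector `v` in the range of the projection
`φ(|j₀⟩⟨j₀|)`. -/
theorem IsUnitaryChannel.exists_conjBy [Nonempty κ] {E : Op κ →ₗ[ℂ] Op ι}
    (hE : IsUnitaryChannel E) :
    ∃ M : Matrix ι κ ℂ, Mᴴ * M = 1 ∧ M * Mᴴ = 1 ∧ E = conjBy M := by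
  obtain ⟨φ, hφ⟩ := hE
  let j₀ : κ := Classical.arbitrary κ
  have hP : φ (Matrix.single j₀ j₀ 1) ≠ 0 := by
    intro h
    have h' : Matrix.single j₀ j₀ (1 : ℂ) = 0 := φ.injective (h.trans (map_zero φ).symm)
    have := congrFun (congrFun h' j₀) j₀
    simp at this
  have hw : ∃ w, φ (Matrix.single j₀ j₀ 1) *ᵥ w ≠ 0 := by
    by_contra! h
    exact hP (Matrix.ext_of_mulVec_single fun i => by rw [h, Matrix.zero_mulVec])
  obtain ⟨w, hw⟩ := hw
  set v₀ := φ (Matrix.single j₀ j₀ 1) *ᵥ w with hv₀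
  have hPv₀ : φ (Matrix.single j₀ j₀ 1) *ᵥ v₀ = v₀ := by
    rw [hv₀, Matrix.mulVec_mulVec, ← map_mul]; simp
  have hnorm : ∃ r : ℂ, star r * r * (star v₀ ⬝ᵥ v₀) = 1 := by
    have hs : star v₀ ⬝ᵥ v₀ = ((∑ i, ‖v₀ i‖ ^ 2 : ℝ) : ℂ) := by
      simp only [dotProduct, Pi.star_apply, RCLike.star_def, RCLike.conj_mul]
      push_cast; rfl
    have hpos : 0 < ∑ i, ‖v₀ i‖ ^ 2 := by
      refine lt_of_le_of_ne (Finset.sum_nonneg fun i _ => by positivity) fun h => hw ?_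
      funext i
      have := (Finset.sum_eq_zero_iff_of_nonneg (fun i _ => by positivity)).1 h.symm i
        (Finset.mem_univ i)
      simpa using this
    set t := ∑ i, ‖v₀ i‖ ^ 2
    refine ⟨(((Real.sqrt t)⁻¹ : ℝ) : ℂ), ?_⟩
    rw [hs, RCLike.star_def, Complex.conj_ofReal, ← Complex.ofReal_mul, ← Complex.ofReal_mul,
      ← mul_inv, Real.mul_self_sqrt hpos.le, inv_mul_cancel₀ hpos.ne', Complex.ofReal_one]
  obtain ⟨r, hr⟩ := hnorm
  set v := r • v₀ with hv
  have hPv : φ (Matrix.single j₀ j₀ 1) *ᵥ v = v := by rw [hv, Matrix.mulVec_smul, hPv₀]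
  have hvv : star v ⬝ᵥ v = 1 := by
    rw [← hr, hv]; simp [mul_assoc, mul_left_comm]
  let M : Matrix ι κ ℂ := Matrix.of fun i j => (φ (Matrix.single j j₀ 1) *ᵥ v) i
  have h₁ : Mᴴ * M = 1 := by
    ext j k
    have : (Mᴴ * M) j k
        = star (φ (Matrix.single j j₀ 1) *ᵥ v) ⬝ᵥ (φ (Matrix.single k j₀ 1) *ᵥ v) := rfl
    rw [this, Matrix.star_mulVec, ← Matrix.dotProduct_mulVec, Matrix.mulVec_mulVec,
      ← Matrix.star_eq_conjTranspose, ← map_star, ← map_mul, Matrix.star_eq_conjTranspose,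
      Matrix.conjTranspose_single, star_one]
    by_cases hjk : j = k
    · subst hjk
      simp [hPv, hvv]
    · simp [hjk]
  have hcard : Fintype.card κ = Fintype.card ι := by
    have h := φ.toAlgEquiv.toLinearEquiv.finrank_eq
    simp only [Module.finrank_matrix, Module.finrank_self, mul_one] at h
    exact Nat.mul_self_inj.1 h
  have h₂ : M * Mᴴ = 1 := (Matrix.mul_eq_one_comm_of_card_eq _ _ _ hcard).1 h₁
  have hint : ∀ X : Op κ, φ X * M = M * X := by
    intro X
    ext i j
    have e₁ : (φ X * M) i j = (φ (X * Matrix.single j j₀ 1) *ᵥ v) i := by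
      rw [map_mul, ← Matrix.mulVec_mulVec]; rfl
    have e₂ : X * Matrix.single j j₀ 1 = ∑ k, X k j • Matrix.single k j₀ (1 : ℂ) := by
      ext a b
      rw [Matrix.sum_apply, Finset.sum_eq_single a]
      · by_cases hb : j₀ = b
        · subst hb; simp
        · simp [hb, Matrix.mul_apply]
      · intro c _ hc; simp [hc]
      · simp
    rw [e₁, e₂, map_sum, Matrix.sum_mulVec, Matrix.mul_apply, Finset.sum_apply]
    refine Finset.sum_congr rfl fun k _ => ?_
    rw [map_smul, Matrix.smul_mulVec, Pi.smul_apply, smul_eq_mul, mul_comm]; rfl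
  refine ⟨M, h₁, h₂, LinearMap.ext fun X => ?_⟩
  rw [hφ, conjBy_apply, ← hint, Matrix.mul_assoc, h₂, Matrix.mul_one]

end

section Tensor

variable {ι κ ι' κ' : Type*} [Fintype κ] [DecidableEq κ] [Fintype κ'] [DecidableEq κ']

theorem tensorMap_conjBy (M : Matrix ι κ ℂ) (N : Matrix ι' κ' ℂ) :
    tensorMap (conjBy M) (conjBy N) = conjBy (M ⊗ₖ N) := by
  rw [← ofCoeff_coeff (conjBy (M ⊗ₖ N)), tensorMap]
  congr 1
  funext i i' j j'
  simp only [coeff_conjBy, Matrix.kroneckerMap_apply, star_mul']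
  ring

end Tensor

/-- The permutation of the computational basis of three qubits induced by the two CNOT gates. -/
def copyPerm (s : Fin 3 → Fin 2) : Fin 3 → Fin 2 := ![s 0 + s 1, s 1, s 2 + s 1]

theorem copyPerm_involutive : Function.Involutive copyPerm := by
  unfold Function.Involutive; decide

/-- The unitary matrix of `U₃`: the permutation matrix of `copyPerm`. -/
def copyMatrix : Op (Fin 3 → Fin 2) := Matrix.of fun s' s => if s' = copyPerm s then 1 else 0

theorem copyMatrix_eq : cnot 1 0 * cnot 1 2 = copyMatrix := by
  ext s' s
  rw [Matrix.mul_apply, Finset.sum_eq_single (Function.update s 2 (s 2 + s 1))]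
  · have : Function.update (Function.update s 2 (s 2 + s 1)) 0
        ((Function.update s 2 (s 2 + s 1)) 0 + (Function.update s 2 (s 2 + s 1)) 1)
        = copyPerm s := by
      revert s; decide
    simp only [cnot, copyMatrix, Matrix.of_apply, this, if_true, mul_one]
  · intro t _ ht
    simp [cnot, ht]
  · simp

theorem U3_eq_conjBy : U3 = conjBy copyMatrix := by
  rw [U3, copyMatrix_eq]
  refine LinearMap.ext fun ρ => ?_
  simp [conjMap, conjBy_apply, Matrix.mul_assoc]

theorem copyMatrix_conjTranspose : copyMatrixᴴ = copyMatrix := by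
  ext s' s
  have h : s = copyPerm s' ↔ s' = copyPerm s :=
    ⟨fun h => by rw [h, copyPerm_involutive], fun h => by rw [h, copyPerm_involutive]⟩
  simp only [copyMatrix, Matrix.conjTranspose_apply, Matrix.of_apply, h]
  split_ifs <;> simp

theorem copyMatrix_conj (M : Op (Fin 3 → Fin 2)) (s' s : Fin 3 → Fin 2) :
    (copyMatrixᴴ * M * copyMatrix) s' s = M (copyPerm s') (copyPerm s) := by
  rw [copyMatrix_conjTranspose, Matrix.mul_apply, Finset.sum_eq_single (copyPerm s)]
  · rw [Matrix.mul_apply, Finset.sum_eq_single (copyPerm s')]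
    · simp [copyMatrix, copyPerm_involutive s']
    · intro t _ ht
      have : s' ≠ copyPerm t := fun h => ht (by rw [h, copyPerm_involutive])
      simp [copyMatrix, this]
    · simp
  · intro t _ ht
    simp [copyMatrix, ht]
  · simp

theorem copyMatrix_mul_self : copyMatrix * copyMatrix = 1 := by
  ext s' s
  have h := copyMatrix_conj 1 s' s
  rw [Matrix.mul_one, copyMatrix_conjTranspose] at h
  rw [h]
  simp [Matrix.one_apply, copyPerm_involutive.injective.eq_iff]

section TensorU3

variable {A B : Type*} [Fintype A] [DecidableEq A] [Fintype B] [DecidableEq B]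
  {HA : A → Type*} {HB : B → Type*} (a : Fin 3 → A) (b : Fin 3 → B)

/-- The unitary matrix of `U₃ ⊗ V`, where `v` is the unitary matrix of `V`. -/
def tensorMatrix (v : Matrix (∀ y, HB y) (∀ x, HA x) ℂ) :
    Matrix (∀ y, WithQubits b HB y) (∀ x, WithQubits a HA x) ℂ :=
  (copyMatrix ⊗ₖ v).submatrix (splitQubits b HB) (splitQubits a HA)

theorem tensorU3_conjBy [∀ x, Fintype (HA x)] [∀ x, DecidableEq (HA x)] [∀ y, Fintype (HB y)]
    [∀ y, DecidableEq (HB y)] (v : Matrix (∀ y, HB y) (∀ x, HA x) ℂ) :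
    tensorU3 a b (conjBy v) = conjBy (tensorMatrix a b v) := by
  rw [tensorU3, U3_eq_conjBy, tensorMap_conjBy, conjBy_submatrix, tensorMatrix]

variable {v : Matrix (∀ y, HB y) (∀ x, HA x) ℂ}

theorem tensorMatrix_conjTranspose_mul [∀ x, DecidableEq (HA x)] [∀ y, Fintype (HB y)]
    (h : vᴴ * v = 1) :
    (tensorMatrix a b v)ᴴ * tensorMatrix a b v = 1 := by
  rw [tensorMatrix, Matrix.conjTranspose_submatrix, Matrix.submatrix_mul_equiv,
    Matrix.conjTranspose_kronecker, ← Matrix.mul_kronecker_mul, h, copyMatrix_conjTranspose,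
    copyMatrix_mul_self, Matrix.one_kronecker_one, Matrix.submatrix_one_equiv]

theorem tensorMatrix_mul_conjTranspose [∀ x, Fintype (HA x)] [∀ y, DecidableEq (HB y)]
    (h : v * vᴴ = 1) :
    tensorMatrix a b v * (tensorMatrix a b v)ᴴ = 1 := by
  rw [tensorMatrix, Matrix.conjTranspose_submatrix, Matrix.submatrix_mul_equiv,
    Matrix.conjTranspose_kronecker, ← Matrix.mul_kronecker_mul, h, copyMatrix_conjTranspose,
    copyMatrix_mul_self, Matrix.one_kronecker_one, Matrix.submatrix_one_equiv]

end TensorU3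

/-! ### The causal structure of `U₃ ⊗ V` -/

section EmbedOp

variable {L : Type*} {H : L → Type*}

theorem embedOp_apply (S : Set L) (m : Op (∀ x : S, H x)) (i j : ∀ x, H x)
    (h : ∀ x, x ∉ S → i x = j x) :
    embedOp S m i j = m (fun x => i x) (fun x => j x) := by
  rw [embedOp, Matrix.of_apply, if_pos h]

theorem embedOp_apply_of_not (S : Set L) (m : Op (∀ x : S, H x)) (i j : ∀ x, H x)
    (h : ¬ ∀ x, x ∉ S → i x = j x) : embedOp S m i j = 0 := by
  rw [embedOp, Matrix.of_apply, if_neg h]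

theorem embedOp_add (S : Set L) (m n : Op (∀ x : S, H x)) :
    embedOp S (m + n) = embedOp S m + embedOp S n := by
  ext i j
  by_cases h : ∀ x, x ∉ S → i x = j x
  · simp only [Matrix.add_apply, embedOp_apply S _ i j h]
  · simp only [Matrix.add_apply, embedOp_apply_of_not S _ i j h, add_zero]

theorem embedOp_smul (S : Set L) (r : ℂ) (m : Op (∀ x : S, H x)) :
    embedOp S (r • m) = r • embedOp S m := by
  ext i j
  by_cases h : ∀ x, x ∉ S → i x = j x
  · simp only [Matrix.smul_apply, embedOp_apply S _ i j h]
  · simp only [Matrix.smul_apply, embedOp_apply_of_not S _ i j h, smul_zero]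

/-- A linear condition on the local operators holds if it holds for the local matrix units. -/
theorem localOps_induction {S : Set L} [Finite (∀ x : S, H x)] [DecidableEq (∀ x : S, H x)]
    {P : Op (∀ x, H x) → Prop} (hzero : P 0) (hadd : ∀ M N, P M → P N → P (M + N))
    (hsmul : ∀ (r : ℂ) M, P M → P (r • M))
    (hsingle : ∀ p q, P (embedOp S (Matrix.single p q 1))) {M : Op (∀ x, H x)}
    (hM : M ∈ localOps H S) : P M := by
  obtain ⟨m, rfl⟩ := hM
  induction m using Matrix.induction_on' with
  | h_zero =>
    have : embedOp S (0 : Op (∀ x : S, H x)) = 0 := by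
      simpa using embedOp_smul S 0 (0 : Op (∀ x : S, H x))
    rwa [this]
  | h_add m n hm hn => rw [embedOp_add]; exact hadd _ _ hm hn
  | h_std_basis p q r =>
    have : Matrix.single p q r = r • Matrix.single p q (1 : ℂ) := by simp
    rw [this, embedOp_smul]
    exact hsmul _ _ (hsingle p q)

/-- An operator that acts trivially on the labels in `S` commutes with the operators that act on the
labels in `S` only. -/
theorem commute_of_mem_localOps [Fintype L] [DecidableEq L] [∀ x, Fintype (H x)] {S : Set L}
    {K N : Op (∀ x, H x)}
    (hK : ∀ k' k, K k' k ≠ 0 → ∀ x ∈ S, k' x = k x)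
    (hK' : ∀ k' k m' m, (∀ x ∉ S, k' x = m' x) → (∀ x ∉ S, k x = m x) → (∀ x ∈ S, k' x = k x) →
      (∀ x ∈ S, m' x = m x) → K k' k = K m' m)
    (hN : N ∈ localOps H S) : Commute K N := by
  classical
  obtain ⟨n, rfl⟩ := hN
  ext k' k
  have p₁ : ∀ {f g : ∀ x, H x} {x}, x ∈ S → S.piecewise f g x = f x := fun {f g x} hx =>
    Set.piecewise_eq_of_mem _ _ _ hx
  have p₂ : ∀ {f g : ∀ x, H x} {x}, x ∉ S → S.piecewise f g x = g x := fun {f g x} hx =>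
    Set.piecewise_eq_of_notMem _ _ _ hx
  rw [Matrix.mul_apply, Matrix.mul_apply, Finset.sum_eq_single (S.piecewise k' k),
    Finset.sum_eq_single (S.piecewise k k')]
  · rw [embedOp_apply S n _ _ fun x hx => p₂ hx, embedOp_apply S n _ _ fun x hx => (p₂ hx).symm,
      mul_comm]
    congr 1
    · congr 1 <;> funext x
      · exact p₁ x.2
      · exact (p₁ x.2).symm
    · exact hK' _ _ _ _ (fun x hx => (p₂ hx).symm) (fun x hx => p₂ hx) (fun x hx => (p₁ hx).symm)
        fun x hx => p₁ hx
  · intro i _ hi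
    by_contra h
    refine hi (funext fun x => ?_)
    by_cases hx : x ∈ S
    · rw [p₁ hx, hK _ _ (right_ne_zero_of_mul h) x hx]
    · rw [p₂ hx]
      by_contra h'
      exact left_ne_zero_of_mul h (embedOp_apply_of_not S n _ _ fun h'' => h' (h'' x hx).symm)
  · simp
  · intro i _ hi
    by_contra h
    refine hi (funext fun x => ?_)
    by_cases hx : x ∈ S
    · rw [p₁ hx, hK _ _ (left_ne_zero_of_mul h) x hx]
    · rw [p₂ hx]
      by_contra h'
      exact right_ne_zero_of_mul h (embedOp_apply_of_not S n _ _ fun h'' => h' (h'' x hx))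
  · simp

end EmbedOp

theorem copyPerm_apply (s : Fin 3 → Fin 2) (x : Fin 3) :
    copyPerm s x = if x = 1 then s 1 else s x + s 1 := by
  fin_cases x <;> rfl

/-- The CNOT gates of `U₃` carry no influence between inputs and outputs that are not related by
`C₃`. -/
theorem copyMatrix_commute {I J : Set (Fin 3)} (h : ∀ i ∈ I, ∀ j ∈ J, ¬ relC3 i j)
    {M N : Op (Fin 3 → Fin 2)} (hM : M ∈ localOps (fun _ => Fin 2) J)
    (hN : N ∈ localOps (fun _ => Fin 2) I) : Commute (copyMatrixᴴ * M * copyMatrix) N := by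
  obtain ⟨m, rfl⟩ := hM
  have hdisj : ∀ i ∈ I, i ∉ J := fun i hi hj => h i hi i hj
    ⟨fun h' => by simp [h'.1] at h', fun h' => by simp [h'.1] at h'⟩
  -- `C₃` relates the middle input to all outputs, and the middle output to all inputs.
  have hJ : I.Nonempty → 1 ∉ J := by
    rintro ⟨i, hi⟩ hj
    exact h i hi 1 hj (by simp [relC3])
  have hI : J.Nonempty → 1 ∉ I := by
    rintro ⟨j, hj⟩ hi
    exact h 1 hi j hj (by simp [relC3])
  have hcongr : 1 ∉ J → ∀ k' k : Fin 3 → Fin 2, (∀ x ∉ J, k' x = k x) →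
      ∀ x ∉ J, copyPerm k' x = copyPerm k x := by
    intro h1 k' k hk x hx
    rw [copyPerm_apply, copyPerm_apply, hk 1 h1, hk x hx]
  have hiff : 1 ∉ J → ∀ k' k : Fin 3 → Fin 2, (∀ x ∉ J, copyPerm k' x = copyPerm k x) ↔
      ∀ x ∉ J, k' x = k x := by
    refine fun h1 k' k => ⟨fun hk => ?_, hcongr h1 k' k⟩
    simpa only [copyPerm_involutive _] using hcongr h1 _ _ hk
  refine commute_of_mem_localOps (fun k' k hk i hi => ?_) (fun k' k n' n hk' hk he he' => ?_) hN
  · rw [copyMatrix_conj] at hk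
    have : ∀ x ∉ J, copyPerm k' x = copyPerm k x := by
      by_contra h'
      exact hk (embedOp_apply_of_not J m _ _ h')
    exact (hiff (hJ ⟨i, hi⟩) k' k).1 this i (hdisj i hi)
  · rw [copyMatrix_conj, copyMatrix_conj]
    rcases I.eq_empty_or_nonempty with rfl | hne
    · rw [funext fun x => hk' x (by simp), funext fun x => hk x (by simp)]
    have hmem : ∀ {s t : Fin 3 → Fin 2}, (∀ x ∉ I, s x = t x) →
        (fun x : J => copyPerm s x) = fun x : J => copyPerm t x := by
      intro s t hst
      funext ⟨x, hx⟩
      simp only [copyPerm_apply]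
      rw [hst 1 (hI ⟨x, hx⟩), hst x fun hi => hdisj x hi hx]
    have hcond : (∀ x ∉ J, k' x = k x) ↔ ∀ x ∉ J, n' x = n x := by
      refine forall₂_congr fun x _ => ?_
      by_cases hx : x ∈ I
      · simp [he x hx, he' x hx]
      · rw [hk' x hx, hk x hx]
    by_cases hc : ∀ x ∉ J, k' x = k x
    · rw [embedOp_apply J m _ _ ((hiff (hJ hne) _ _).2 hc),
        embedOp_apply J m _ _ ((hiff (hJ hne) _ _).2 (hcond.1 hc)), hmem hk', hmem hk]
    · rw [embedOp_apply_of_not J m _ _ fun h' => hc ((hiff (hJ hne) _ _).1 h'),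
        embedOp_apply_of_not J m _ _ fun h' => hc (hcond.2 ((hiff (hJ hne) _ _).1 h'))]

theorem conj_tensorMatrix {A B : Type*} [DecidableEq A] [Fintype B] [DecidableEq B]
    {HA : A → Type*} {HB : B → Type*} [∀ y, Fintype (HB y)] (a : Fin 3 → A)
    (b : Fin 3 → B) (v : Matrix (∀ y, HB y) (∀ x, HA x) ℂ)
    (M : Op (Fin 3 → Fin 2)) (Y : Op (∀ y, HB y)) :
    (tensorMatrix a b v)ᴴ * (M ⊗ₖ Y).submatrix (splitQubits b HB) (splitQubits b HB) *
        tensorMatrix a b v =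
      ((copyMatrixᴴ * M * copyMatrix) ⊗ₖ (vᴴ * Y * v)).submatrix (splitQubits a HA)
        (splitQubits a HA) := by
  rw [tensorMatrix, Matrix.conjTranspose_submatrix, Matrix.submatrix_mul_equiv,
    Matrix.submatrix_mul_equiv, Matrix.conjTranspose_kronecker, Matrix.mul_kronecker_mul,
    Matrix.mul_kronecker_mul]

section TensorU3

variable {A B : Type*} [Fintype A] [DecidableEq A] [Fintype B] [DecidableEq B]
  {HA : A → Type*} {HB : B → Type*} [∀ x, Fintype (HA x)] [∀ x, DecidableEq (HA x)]
  [∀ y, Fintype (HB y)]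

theorem noInfluence_conjBy {M : Matrix (∀ y, HB y) (∀ x, HA x) ℂ} {S : Set A} {T : Set B} :
    NoInfluence (conjBy M) S T ↔
      ∀ Y ∈ localOps HB T, ∀ X ∈ localOps HA S, Commute (Mᴴ * Y * M) X := by
  rw [NoInfluence, Set.image_subset_iff]
  simp only [Set.subset_def, Set.mem_preimage, hsAdjoint_conjBy, Set.mem_centralizer_iff]
  exact forall₂_congr fun Y _ => forall₂_congr fun X _ => eq_comm

variable {L : Type*} [DecidableEq L] (e : Fin 3 → L) (H : L → Type*)

/-- A local matrix unit factors into one on the qubits and one on the other systems. -/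
theorem embedOp_single_withQubits [∀ l, DecidableEq (H l)] [∀ l, Fintype (H l)] (y : L)
    (p q : ∀ x : ({y} : Set L), WithQubits e H x) :
    ∃ M ∈ localOps (fun _ : Fin 3 => Fin 2) {j | e j = y}, ∃ Y ∈ localOps H {y},
      embedOp {y} (Matrix.single p q 1)
        = (M ⊗ₖ Y).submatrix (splitQubits e H) (splitQubits e H) := by
  classical
  refine ⟨_, ⟨Matrix.single (fun j => (p ⟨y, rfl⟩).1 j) (fun j => (q ⟨y, rfl⟩).1 j) 1, rfl⟩,
    _, ⟨Matrix.single (fun x => (p x).2) (fun x => (q x).2) 1, rfl⟩, ?_⟩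
  ext k m
  have hiff : ((∀ x ∉ ({y} : Set L), k x = m x) ∧ p = (fun x : ({y} : Set L) => k x) ∧
      q = fun x : ({y} : Set L) => m x) ↔
      ((∀ j ∉ {j | e j = y}, (splitQubits e H k).1 j = (splitQubits e H m).1 j) ∧
        (fun j : {j | e j = y} => (p ⟨y, rfl⟩).1 j) =
          (fun j : {j | e j = y} => (splitQubits e H k).1 j) ∧
        (fun j : {j | e j = y} => (q ⟨y, rfl⟩).1 j) =
          fun j : {j | e j = y} => (splitQubits e H m).1 j) ∧
      (∀ x ∉ ({y} : Set L), (splitQubits e H k).2 x = (splitQubits e H m).2 x) ∧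
        (fun x => (p x).2) = (fun x : ({y} : Set L) => (splitQubits e H k).2 x) ∧
        (fun x => (q x).2) = fun x : ({y} : Set L) => (splitQubits e H m).2 x := by
    constructor
    · rintro ⟨h, rfl, rfl⟩
      refine ⟨⟨fun j hj => congrFun (congrArg Prod.fst (h (e j) hj)) ⟨j, rfl⟩, ?_, ?_⟩,
        fun x hx => congrArg Prod.snd (h x hx), rfl, rfl⟩ <;>
      · funext ⟨j, hj⟩
        obtain rfl : e j = y := hj
        rfl
    · rintro ⟨⟨h₁, hp₁, hq₁⟩, h₂, hp₂, hq₂⟩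
      refine ⟨fun x hx => Prod.ext (funext fun ⟨j, hj⟩ => ?_) (h₂ x hx), ?_, ?_⟩
      · subst hj
        exact h₁ j hx
      · have hqubit : ∀ j (hj : e j = y), (p ⟨y, rfl⟩).1 ⟨j, hj⟩ = (k y).1 ⟨j, hj⟩ := by
          rintro j rfl
          exact congrFun hp₁ ⟨j, rfl⟩
        funext ⟨x, hx⟩
        obtain rfl : x = y := hx
        exact Prod.ext (funext fun ⟨j, hj⟩ => hqubit j hj) (congrFun hp₂ ⟨x, rfl⟩)
      · have hqubit : ∀ j (hj : e j = y), (q ⟨y, rfl⟩).1 ⟨j, hj⟩ = (m y).1 ⟨j, hj⟩ := by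
          rintro j rfl
          exact congrFun hq₁ ⟨j, rfl⟩
        funext ⟨x, hx⟩
        obtain rfl : x = y := hx
        exact Prod.ext (funext fun ⟨j, hj⟩ => hqubit j hj) (congrFun hq₂ ⟨x, rfl⟩)
  simp only [embedOp, Matrix.of_apply, Matrix.submatrix_apply, Matrix.kroneckerMap_apply,
    Matrix.single_apply, ← ite_and, ite_zero_mul_ite_zero, mul_one]
  by_cases hk : (∀ x ∉ ({y} : Set L), k x = m x) ∧ p = (fun x : ({y} : Set L) => k x) ∧
      q = fun x : ({y} : Set L) => m x
  · rw [if_pos hk, if_pos (hiff.1 hk)]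
  · rw [if_neg hk, if_neg fun h => hk (hiff.2 h)]

/-- An operator on the original systems that is local at `y` is local at `y` also when the qubits are
added. -/
theorem one_kronecker_mem_localOps (y : L) {Y : Op (∀ l, H l)} (hY : Y ∈ localOps H {y}) :
    ((1 : Op (Fin 3 → Fin 2)) ⊗ₖ Y).submatrix (splitQubits e H) (splitQubits e H) ∈
      localOps (WithQubits e H) {y} := by
  classical
  obtain ⟨m, rfl⟩ := hY
  refine ⟨Matrix.of fun p q => if (p ⟨y, rfl⟩).1 = (q ⟨y, rfl⟩).1 then
    m (fun x => (p x).2) (fun x => (q x).2) else 0, ?_⟩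
  ext k n
  have hiff : ((∀ x ∉ ({y} : Set L), k x = n x) ∧ (k y).1 = (n y).1) ↔
      (splitQubits e H k).1 = (splitQubits e H n).1 ∧
        ∀ x ∉ ({y} : Set L), (splitQubits e H k).2 x = (splitQubits e H n).2 x := by
    constructor
    · rintro ⟨h, hy⟩
      refine ⟨funext fun j => ?_, fun x hx => congrArg Prod.snd (h x hx)⟩
      by_cases hj : e j = y
      · subst hj
        exact congrFun hy ⟨j, rfl⟩
      · exact congrFun (congrArg Prod.fst (h (e j) hj)) ⟨j, rfl⟩
    · rintro ⟨h₁, h₂⟩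
      refine ⟨fun x hx => Prod.ext (funext fun ⟨j, hj⟩ => ?_) (h₂ x hx), funext fun ⟨j, hj⟩ => ?_⟩
      · subst hj
        exact congrFun h₁ j
      · subst hj
        exact congrFun h₁ j
  simp only [embedOp, Matrix.of_apply, Matrix.submatrix_apply, Matrix.kroneckerMap_apply,
    Matrix.one_apply, ite_mul, one_mul, zero_mul, ← ite_and]
  by_cases hk : (∀ x ∉ ({y} : Set L), k x = n x) ∧ (k y).1 = (n y).1
  · rw [if_pos hk, if_pos (hiff.1 hk)]
    rfl
  · rw [if_neg hk, if_neg fun h => hk (hiff.2 h)]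

end TensorU3

theorem causalStructure_tensorU3
    {A B : Type*} [Fintype A] [DecidableEq A] [Fintype B] [DecidableEq B]
    {HA : A → Type*} {HB : B → Type*} [∀ x, Fintype (HA x)] [∀ x, DecidableEq (HA x)]
    [∀ y, Fintype (HB y)] [∀ y, DecidableEq (HB y)] {a : Fin 3 → A} {b : Fin 3 → B}
    (v : Matrix (∀ y, HB y) (∀ x, HA x) ℂ)
    (hG : RestrictsToC3 (causalStructure (conjBy v)) a b) :
    causalStructure (tensorU3 a b (conjBy v)) = causalStructure (conjBy v) := by
  funext x y
  rw [causalStructure, causalStructure, eq_iff_iff, not_iff_not, tensorU3_conjBy,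
    noInfluence_conjBy, noInfluence_conjBy]
  refine ⟨fun h Y hY X hX => ?_, fun h Y hY X hX => ?_⟩
  · have := h _ (one_kronecker_mem_localOps b HB y hY) _ (one_kronecker_mem_localOps a HA x hX)
    rw [conj_tensorMatrix, Matrix.mul_one, copyMatrix_conjTranspose, copyMatrix_mul_self] at this
    have e := this.eq
    rw [Matrix.submatrix_mul_equiv, Matrix.submatrix_mul_equiv, ← Matrix.mul_kronecker_mul,
      ← Matrix.mul_kronecker_mul, Matrix.mul_one] at e
    ext i j
    have := congrFun (congrFun e ((splitQubits a HA).symm (0, i))) ((splitQubits a HA).symm (0, j))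
    simpa using this
  · classical
    have hI : ∀ i ∈ {i | a i = x}, ∀ j ∈ {j | b j = y}, ¬ relC3 i j := by
      rintro i rfl j rfl hij
      exact (hG i j).2 hij (noInfluence_conjBy.2 h)
    refine localOps_induction (P := fun Y => Commute ((tensorMatrix a b v)ᴴ * Y *
      tensorMatrix a b v) X) ?_ (fun M N hM hN => ?_) (fun r M hM => ?_) (fun p q => ?_) hY
    · simp
    · rw [Matrix.mul_add, Matrix.add_mul]
      exact hM.add_left hN
    · rw [Matrix.mul_smul, Matrix.smul_mul]
      exact hM.smul_left r
    refine localOps_induction (P := fun X => Commute _ X) (Commute.zero_right _)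
      (fun M N hM hN => hM.add_right hN) (fun r M hM => hM.smul_right r) (fun p' q' => ?_) hX
    obtain ⟨M, hM, Y, hY, hMY⟩ := embedOp_single_withQubits b HB y p q
    obtain ⟨N, hN, X, hX, hNX⟩ := embedOp_single_withQubits a HA x p' q'
    rw [hMY, hNX, conj_tensorMatrix]
    have e₁ := (copyMatrix_commute hI hM hN).eq
    have e₂ := (h Y hY X hX).eq
    rw [Commute, SemiconjBy, Matrix.submatrix_mul_equiv, Matrix.submatrix_mul_equiv,
      ← Matrix.mul_kronecker_mul, ← Matrix.mul_kronecker_mul, e₁, e₂]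

/-! ### Local operators and exchange operators -/

section ActsOn

variable {L : Type*} {H : L → Type*}

/-- The operator `M` on the composite of all systems acts on the labels in `T` only. Outside of `T`
it preserves the basis label, and it commutes with all permutations of the basis labels. -/
def ActsOn (T : Set L) (M : Op (∀ l, H l)) : Prop :=
  (∀ k' k, M k' k ≠ 0 → ∀ l ∉ T, k' l = k l) ∧
    ∀ σ : ∀ l, Equiv.Perm (H l), (∀ l ∈ T, σ l = 1) →
      M.submatrix (Equiv.piCongrRight σ) (Equiv.piCongrRight σ) = M

theorem ActsOn.mono {T T' : Set L} {M : Op (∀ l, H l)} (h : ActsOn T M) (hT : T ⊆ T') :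
    ActsOn T' M :=
  ⟨fun k' k hk l hl => h.1 k' k hk l fun hl' => hl (hT hl'),
    fun σ hσ => h.2 σ fun l hl => hσ l (hT hl)⟩

theorem ActsOn.conjTranspose {T : Set L} {M : Op (∀ l, H l)} (h : ActsOn T M) : ActsOn T Mᴴ := by
  refine ⟨fun k' k hk l hl => (h.1 k k' (fun h0 => hk ?_) l hl).symm, fun σ hσ => ?_⟩
  · simp [h0]
  · rw [← Matrix.conjTranspose_submatrix, h.2 σ hσ]

/-- An operator that acts on the labels in `T` only, and also on the labels in a disjoint set `T'`
only, is a scalar. -/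
theorem ActsOn.apply_of_disjoint [∀ l, DecidableEq (H l)] {T T' : Set L} {M : Op (∀ l, H l)}
    (h : ActsOn T M) (h' : ActsOn T' M) (hT : Disjoint T T') :
    (∀ k' k, k' ≠ k → M k' k = 0) ∧ ∀ k m, M k k = M m m := by
  classical
  refine ⟨fun k' k hk => ?_, fun k m => ?_⟩
  · by_contra h0
    refine hk (funext fun l => ?_)
    by_cases hl : l ∈ T
    · exact h'.1 _ _ h0 l (hT.notMem_of_mem_left hl)
    · exact h.1 _ _ h0 l hl
  · -- Move `k` to `m` in two steps: first outside of `T`, then inside of `T`.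
    let σ : ∀ l, Equiv.Perm (H l) := fun l => if l ∈ T then 1 else Equiv.swap (k l) (m l)
    let τ : ∀ l, Equiv.Perm (H l) := fun l => if l ∈ T then Equiv.swap (k l) (m l) else 1
    have e₁ := congrFun (congrFun (h.2 σ fun l hl => by simp [σ, hl]) k) k
    have e₂ := congrFun (congrFun (h'.2 τ fun l hl => by
      simp [τ, hT.notMem_of_mem_right hl]) (Equiv.piCongrRight σ k)) (Equiv.piCongrRight σ k)
    have e₃ : Equiv.piCongrRight τ (Equiv.piCongrRight σ k) = m := by
      funext l
      by_cases hl : l ∈ T <;> simp [σ, τ, hl]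
    rw [Matrix.submatrix_apply, e₃] at e₂
    rw [Matrix.submatrix_apply] at e₁
    rw [← e₁, ← e₂]

theorem actsOn_diagonal [Fintype L] [DecidableEq L] [∀ l, DecidableEq (H l)] (l : L)
    (f : H l → ℂ) :
    ActsOn {l} (Matrix.diagonal fun k : ∀ l, H l => f (k l)) := by
  refine ⟨fun k' k hk l' _ => ?_, fun σ hσ => ?_⟩
  · have : k' = k := by
      by_contra h
      exact hk (Matrix.diagonal_apply_ne _ h)
    rw [this]
  · rw [Matrix.submatrix_diagonal_equiv]
    congr 1
    funext k
    simp [hσ l rfl]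

variable [Fintype L]

theorem ActsOn.mul [DecidableEq L] [∀ l, Fintype (H l)] {T : Set L} {M N : Op (∀ l, H l)}
    (hM : ActsOn T M) (hN : ActsOn T N) :
    ActsOn T (M * N) := by
  refine ⟨fun k' k hk l hl => ?_, fun σ hσ => ?_⟩
  · obtain ⟨n, -, hn⟩ := Finset.exists_ne_zero_of_sum_ne_zero hk
    exact (hM.1 _ _ (left_ne_zero_of_mul hn) l hl).trans (hN.1 _ _ (right_ne_zero_of_mul hn) l hl)
  · rw [← Matrix.submatrix_mul_equiv _ _ _ (Equiv.piCongrRight σ), hM.2 σ hσ, hN.2 σ hσ]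

theorem actsOn_one [∀ l, DecidableEq (H l)] (T : Set L) : ActsOn T (1 : Op (∀ l, H l)) := by
  refine ⟨fun k' k hk l _ => ?_, fun σ _ => ?_⟩
  · have : k' = k := by
      by_contra h
      exact hk (Matrix.one_apply_ne h)
    rw [this]
  · rw [Matrix.submatrix_one_equiv]

variable [DecidableEq L] [∀ l, Fintype (H l)] [∀ l, DecidableEq (H l)]

theorem actsOn_list_prod {T : Set L} {l : List (Op (∀ l, H l))} (h : ∀ M ∈ l, ActsOn T M) :
    ActsOn T l.prod := by
  induction l with
  | nil => exact actsOn_one T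
  | cons M l ih =>
    rw [List.prod_cons]
    exact (h M (by simp)).mul (ih fun N hN => h N (by simp [hN]))

theorem ActsOn.commute_diagonal {T : Set L} {M : Op (∀ l, H l)} (h : ActsOn T M) {l : L}
    (hl : l ∉ T) (f : H l → ℂ) : Commute (Matrix.diagonal fun k : ∀ l, H l => f (k l)) M := by
  ext k' k
  rw [Matrix.diagonal_mul, Matrix.mul_diagonal]
  by_cases h0 : M k' k = 0
  · simp [h0]
  · rw [h.1 _ _ h0 l hl, mul_comm]

end ActsOn

section Exchange

/-- A gate with input basis `I` and output basis `O` in a network whose wires are the labels in `L`: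
the wires that enter and leave the gate, and the identification of `I` and `O` with the bases of the
wires that enter and leave. -/
structure GateSlot {L : Type*} (H : L → Type*) (I O : Type*) where
  ins : Set L
  outs : Set L
  disjoint : Disjoint ins outs
  readIn : (∀ l, H l) → I
  readOut : (∀ l, H l) → O
  readIn_eq_iff : ∀ k m, readIn k = readIn m ↔ ∀ l ∈ ins, k l = m l
  readOut_eq_iff : ∀ k m, readOut k = readOut m ↔ ∀ l ∈ outs, k l = m l
  exists_write : ∀ (k : ∀ l, H l) i o,
    ∃ m, readIn m = i ∧ readOut m = o ∧ ∀ l, l ∉ ins → l ∉ outs → m l = k l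

variable {L : Type*} {H : L → Type*}

open Classical in
/-- The exchange operator of a gate with matrix `U`. It is the unitary `(U* ⊗ U) ∘ SWAP` on the wires
that enter and leave the gate, and the identity on all other wires. -/
noncomputable def exchange {I O : Type*} (s : GateSlot H I O) (U : Matrix O I ℂ) :
    Op (∀ l, H l) :=
  Matrix.of fun k' k => if ∀ l, l ∉ s.ins → l ∉ s.outs → k' l = k l then
    U (s.readOut k') (s.readIn k) * star (U (s.readOut k) (s.readIn k')) else 0

variable {I O : Type*} (s : GateSlot H I O) (U : Matrix O I ℂ)

theorem conjTranspose_exchange : (exchange s U)ᴴ = exchange s U := by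
  ext k' k
  simp only [exchange, Matrix.conjTranspose_apply, Matrix.of_apply]
  by_cases h : ∀ l, l ∉ s.ins → l ∉ s.outs → k' l = k l
  · rw [if_pos h, if_pos fun l h₁ h₂ => (h l h₁ h₂).symm]
    simp [mul_comm]
  · rw [if_neg h, if_neg fun h' => h fun l h₁ h₂ => (h' l h₁ h₂).symm, star_zero]

theorem actsOn_exchange : ActsOn (s.ins ∪ s.outs) (exchange s U) := by
  refine ⟨fun k' k hk l hl => ?_, fun σ hσ => ?_⟩
  · have : ∀ l, l ∉ s.ins → l ∉ s.outs → k' l = k l := by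
      by_contra h
      exact hk (by rw [exchange, Matrix.of_apply, if_neg h])
    exact this l (fun h => hl (Or.inl h)) fun h => hl (Or.inr h)
  · have hI : ∀ k, s.readIn (Equiv.piCongrRight σ k) = s.readIn k := fun k =>
      (s.readIn_eq_iff _ _).2 fun l hl => by simp [hσ l (Or.inl hl)]
    have hO : ∀ k, s.readOut (Equiv.piCongrRight σ k) = s.readOut k := fun k =>
      (s.readOut_eq_iff _ _).2 fun l hl => by simp [hσ l (Or.inr hl)]
    classical
    ext k' k
    have hσ' : ∀ l, Equiv.piCongrRight σ k' l = Equiv.piCongrRight σ k l ↔ k' l = k l :=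
      fun l => (σ l).injective.eq_iff
    simp only [exchange, Matrix.submatrix_apply, Matrix.of_apply, hI, hO]
    exact if_congr (forall_congr' fun l => imp_congr_right fun _ => imp_congr_right fun _ => hσ' l)
      rfl rfl

variable [Fintype L] [DecidableEq L] [∀ l, Fintype (H l)] [∀ l, DecidableEq (H l)] [Fintype I]
  [DecidableEq I] [Fintype O] [DecidableEq O]

theorem exchange_mul_self (h₁ : Uᴴ * U = 1) (h₂ : U * Uᴴ = 1) :
    exchange s U * exchange s U = 1 := by
  classical
  ext k' k
  rw [Matrix.mul_apply]
  by_cases hk : ∀ l, l ∉ s.ins → l ∉ s.outs → k' l = k l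
  · -- The intermediate label is determined by what the gate reads on its input and output wires.
    have e : ∑ n, exchange s U k' n * exchange s U n k
        = ∑ x : I × O, (U (s.readOut k') x.1 * star (U x.2 (s.readIn k'))) *
            (U x.2 (s.readIn k) * star (U (s.readOut k) x.1)) := by
      rw [← Finset.sum_filter_add_sum_filter_not _
        (fun n => ∀ l, l ∉ s.ins → l ∉ s.outs → n l = k l)]
      rw [Finset.sum_eq_zero (s := Finset.univ.filter fun n => ¬ _), add_zero]
      · refine Finset.sum_bij (fun n _ => (s.readIn n, s.readOut n)) (fun _ _ => Finset.mem_univ _)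
          ?_ ?_ ?_
        · intro n hn m hm h
          simp only [Prod.mk.injEq, s.readIn_eq_iff, s.readOut_eq_iff] at h
          simp only [Finset.mem_filter, Finset.mem_univ, true_and] at hn hm
          funext l
          by_cases hi : l ∈ s.ins
          · exact h.1 l hi
          by_cases ho : l ∈ s.outs
          · exact h.2 l ho
          rw [hn l hi ho, hm l hi ho]
        · rintro ⟨i, o⟩ -
          obtain ⟨m, hi, ho, hm⟩ := s.exists_write k i o
          exact ⟨m, by simpa using hm, by simp [hi, ho]⟩
        · intro n hn
          replace hn := (Finset.mem_filter.1 hn).2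
          simp only [exchange, Matrix.of_apply]
          rw [if_pos hn, if_pos fun l hi ho => (hk l hi ho).trans (hn l hi ho).symm]
      · intro n hn
        replace hn := (Finset.mem_filter.1 hn).2
        rw [exchange, Matrix.of_apply, Matrix.of_apply, if_neg hn, mul_zero]
    have e' : ∑ x : I × O, (U (s.readOut k') x.1 * star (U x.2 (s.readIn k'))) *
            (U x.2 (s.readIn k) * star (U (s.readOut k) x.1))
        = (U * Uᴴ) (s.readOut k') (s.readOut k) * (Uᴴ * U) (s.readIn k') (s.readIn k) := by
      rw [Matrix.mul_apply, Matrix.mul_apply, Finset.sum_mul_sum, Fintype.sum_prod_type]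
      refine Finset.sum_congr rfl fun i _ => Finset.sum_congr rfl fun o _ => ?_
      simp only [Matrix.conjTranspose_apply]
      ring
    rw [e, e', h₁, h₂]
    by_cases hkk : k' = k
    · rw [hkk, Matrix.one_apply_eq, Matrix.one_apply_eq, Matrix.one_apply_eq, mul_one]
    · rw [Matrix.one_apply_ne hkk]
      by_cases hi : s.readIn k' = s.readIn k
      · rw [Matrix.one_apply_ne, zero_mul]
        refine fun ho => hkk (funext fun l => ?_)
        by_cases hli : l ∈ s.ins
        · exact (s.readIn_eq_iff _ _).1 hi l hli
        by_cases hlo : l ∈ s.outs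
        · exact (s.readOut_eq_iff _ _).1 ho l hlo
        exact hk l hli hlo
      · rw [Matrix.one_apply_ne hi, mul_zero]
  · rw [Matrix.one_apply_ne fun h => hk fun l _ _ => congrFun h l]
    refine Finset.sum_eq_zero fun n _ => ?_
    by_cases hn : ∀ l, l ∉ s.ins → l ∉ s.outs → k' l = n l
    · have : ¬ ∀ l, l ∉ s.ins → l ∉ s.outs → n l = k l := fun h =>
        hk fun l hi ho => (hn l hi ho).trans (h l hi ho)
      rw [exchange, Matrix.of_apply, Matrix.of_apply, if_neg this, mul_zero]
    · rw [exchange, Matrix.of_apply, Matrix.of_apply, if_neg hn, zero_mul]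

end Exchange

section Network

variable {L : Type*} [Fintype L] [DecidableEq L] {H : L → Type*} [∀ l, Fintype (H l)]
  [∀ l, DecidableEq (H l)] {P : Type*} {I O : P → Type*}
  (s : ∀ p, GateSlot H (I p) (O p)) (U : ∀ p, Matrix (O p) (I p) ℂ)

open Classical in
/-- The contraction of the gates in the list `l`: the sum over the labels of the internal wires, for
given labels `k` of the wires that enter and `k'` of the wires that leave. -/
noncomputable def contraction (l : List P) (k' k : ∀ x, H x) : ℂ :=
  ∑ w : ∀ x, H x, if (∀ x, (∀ p ∈ l, x ∉ (s p).outs) → w x = k x) ∧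
      (∀ x, (∀ p ∈ l, x ∉ (s p).ins) → w x = k' x) then
    (l.map fun p => U p ((s p).readOut w) ((s p).readIn w)).prod else 0

/-- The product of the exchange operators of gates, where the gates that act first come last in the
list: it carries the wires that enter to the wires that leave by the contraction of the gates, and,
independently, the wires that leave back by the inverse gates. -/
theorem exchange_prod_apply (l : List P)
    (hl : l.Pairwise fun p q => Disjoint (s p).outs (s q).ins ∧ Disjoint (s p).outs (s q).outs ∧
      Disjoint (s p).ins (s q).ins) (k' k : ∀ x, H x) :
    (l.map fun p => exchange (s p) (U p)).prod k' k = contraction s U l k' k *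
      (l.map fun p => star (U p ((s p).readOut k) ((s p).readIn k'))).prod := by
  classical
  induction l generalizing k' with
  | nil =>
    simp only [contraction, List.map_nil, List.prod_nil, List.not_mem_nil, false_imp_iff,
      implies_true, true_imp_iff, mul_one]
    by_cases h : k' = k
    · subst h
      rw [Finset.sum_eq_single k']
      · simp
      · intro w _ hw
        rw [if_neg fun h => hw (funext h.1)]
      · simp
    · rw [Matrix.one_apply_ne h, Finset.sum_eq_zero]
      intro w _
      rw [if_neg]
      exact fun hw => h (funext fun x => (hw.2 x).symm.trans (hw.1 x))
  | cons p l ih =>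
    rw [List.pairwise_cons] at hl
    obtain ⟨hp, hl⟩ := hl
    have hself := (s p).disjoint
    -- The right-hand side sums over the labels `w'` of the internal wires of all gates. On the left
    -- there are the labels `n` between the two factors and the labels `w` of the internal wires of
    -- the gates in `l`; here `n` is determined by `w`, and `w'` differs from `w` on the wires that
    -- leave `p`, where `w'` is `k'` and `w` is `k`.
    have hL : ∀ n, exchange (s p) (U p) k' n * (l.map fun p => exchange (s p) (U p)).prod n k
        = ∑ w : ∀ x, H x, if (∀ x, x ∉ (s p).ins → x ∉ (s p).outs → k' x = n x) ∧
            (∀ x, (∀ q ∈ l, x ∉ (s q).outs) → w x = k x) ∧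
            (∀ x, (∀ q ∈ l, x ∉ (s q).ins) → w x = n x) then
          U p ((s p).readOut k') ((s p).readIn n) * star (U p ((s p).readOut n) ((s p).readIn k')) *
            ((l.map fun q => U q ((s q).readOut w) ((s q).readIn w)).prod *
              (l.map fun q => star (U q ((s q).readOut k) ((s q).readIn n))).prod) else 0 := by
      intro n
      rw [ih hl, contraction, Finset.sum_mul, Finset.mul_sum]
      refine Finset.sum_congr rfl fun w _ => ?_
      rw [exchange, Matrix.of_apply]
      by_cases h₁ : ∀ x, x ∉ (s p).ins → x ∉ (s p).outs → k' x = n x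
      · by_cases h₂ : (∀ x, (∀ q ∈ l, x ∉ (s q).outs) → w x = k x) ∧
            (∀ x, (∀ q ∈ l, x ∉ (s q).ins) → w x = n x)
        · rw [if_pos h₁, if_pos h₂, if_pos ⟨h₁, h₂⟩]
        · rw [if_neg h₂, zero_mul, mul_zero]
          exact (if_neg fun h => h₂ h.2).symm
      · rw [if_neg h₁, zero_mul]
        exact (if_neg fun h => h₁ h.1).symm
    rw [List.map_cons, List.prod_cons, Matrix.mul_apply, Finset.sum_congr rfl fun n _ => hL n,
      ← Fintype.sum_prod_type', ← Finset.sum_filter, contraction, ← Finset.sum_filter,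
      Finset.sum_mul]
    have hpi : ∀ x ∈ (s p).ins, ∀ q ∈ l, x ∉ (s q).ins := fun x hx q hq =>
      (hp q hq).2.2.notMem_of_mem_left hx
    have hpo : ∀ x ∈ (s p).outs, ∀ q ∈ l, x ∉ (s q).ins := fun x hx q hq =>
      (hp q hq).1.notMem_of_mem_left hx
    have hpoo : ∀ x ∈ (s p).outs, ∀ q ∈ l, x ∉ (s q).outs := fun x hx q hq =>
      (hp q hq).2.1.notMem_of_mem_left hx
    have hio : ∀ x ∈ (s p).ins, x ∉ (s p).outs := fun x hx => hself.notMem_of_mem_left hx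
    refine Finset.sum_nbij' (fun x => (s p).outs.piecewise k' x.2)
      (fun w => ((s p).ins.piecewise w ((s p).outs.piecewise k k'), (s p).outs.piecewise k w))
      ?_ ?_ ?_ ?_ ?_
    · rintro ⟨n, w⟩ h
      simp only [Finset.mem_filter, Finset.mem_univ, true_and] at h ⊢
      obtain ⟨h₁, h₂, h₃⟩ := h
      refine ⟨fun x hx => ?_, fun x hx => ?_⟩
      · rw [Set.piecewise_eq_of_notMem _ _ _ (hx p (by simp))]
        exact h₂ x fun q hq => hx q (by simp [hq])
      · by_cases ho : x ∈ (s p).outs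
        · rw [Set.piecewise_eq_of_mem _ _ _ ho]
        · rw [Set.piecewise_eq_of_notMem _ _ _ ho, h₃ x fun q hq => hx q (by simp [hq]),
            h₁ x (hx p (by simp)) ho]
    · intro w h
      simp only [Finset.mem_filter, Finset.mem_univ, true_and] at h ⊢
      obtain ⟨h₁, h₂⟩ := h
      refine ⟨fun x hi ho => ?_, fun x hx => ?_, fun x hx => ?_⟩
      · rw [Set.piecewise_eq_of_notMem _ _ _ hi, Set.piecewise_eq_of_notMem _ _ _ ho]
      · by_cases ho : x ∈ (s p).outs
        · rw [Set.piecewise_eq_of_mem _ _ _ ho]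
        · rw [Set.piecewise_eq_of_notMem _ _ _ ho]
          exact h₁ x (by simpa [ho] using hx)
      · by_cases hi : x ∈ (s p).ins
        · rw [Set.piecewise_eq_of_mem _ _ _ hi, Set.piecewise_eq_of_notMem _ _ _ (hio x hi)]
        · rw [Set.piecewise_eq_of_notMem _ _ _ hi]
          by_cases ho : x ∈ (s p).outs
          · rw [Set.piecewise_eq_of_mem _ _ _ ho, Set.piecewise_eq_of_mem _ _ _ ho]
          · rw [Set.piecewise_eq_of_notMem _ _ _ ho, Set.piecewise_eq_of_notMem _ _ _ ho]
            exact h₂ x (by simpa [hi] using hx)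
    · rintro ⟨n, w⟩ h
      simp only [Finset.mem_filter, Finset.mem_univ, true_and] at h
      obtain ⟨h₁, h₂, h₃⟩ := h
      refine Prod.ext (funext fun x => ?_) (funext fun x => ?_)
      · by_cases hi : x ∈ (s p).ins
        · simp only [Set.piecewise_eq_of_mem _ _ _ hi, Set.piecewise_eq_of_notMem _ _ _ (hio x hi)]
          exact h₃ x (hpi x hi)
        · by_cases ho : x ∈ (s p).outs
          · simp only [Set.piecewise_eq_of_notMem _ _ _ hi, Set.piecewise_eq_of_mem _ _ _ ho]
            rw [← h₂ x (hpoo x ho), h₃ x (hpo x ho)]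
          · simp only [Set.piecewise_eq_of_notMem _ _ _ hi, Set.piecewise_eq_of_notMem _ _ _ ho]
            exact h₁ x hi ho
      · by_cases ho : x ∈ (s p).outs
        · simp only [Set.piecewise_eq_of_mem _ _ _ ho]
          exact (h₂ x (hpoo x ho)).symm
        · simp only [Set.piecewise_eq_of_notMem _ _ _ ho]
    · intro w h
      simp only [Finset.mem_filter, Finset.mem_univ, true_and] at h
      funext x
      by_cases ho : x ∈ (s p).outs
      · simp only [Set.piecewise_eq_of_mem _ _ _ ho]
        refine (h.2 x fun q hq => ?_).symm
        rcases List.mem_cons.1 hq with rfl | hq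
        · exact fun hi => hio x hi ho
        · exact hpo x ho q hq
      · simp only [Set.piecewise_eq_of_notMem _ _ _ ho]
    · rintro ⟨n, w⟩ h
      simp only [Finset.mem_filter, Finset.mem_univ, true_and] at h
      obtain ⟨h₁, h₂, h₃⟩ := h
      have e₁ : (s p).readOut ((s p).outs.piecewise k' w) = (s p).readOut k' :=
        ((s p).readOut_eq_iff _ _).2 fun x hx => Set.piecewise_eq_of_mem _ _ _ hx
      have e₂ : (s p).readIn ((s p).outs.piecewise k' w) = (s p).readIn n :=
        ((s p).readIn_eq_iff _ _).2 fun x hx => by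
          rw [Set.piecewise_eq_of_notMem _ _ _ (hio x hx), h₃ x (hpi x hx)]
      have e₃ : (s p).readOut n = (s p).readOut k :=
        ((s p).readOut_eq_iff _ _).2 fun x hx => by
          rw [← h₂ x (hpoo x hx), h₃ x (hpo x hx)]
      have e₄ : ∀ q ∈ l, (s q).readOut ((s p).outs.piecewise k' w) = (s q).readOut w := fun q hq =>
        ((s q).readOut_eq_iff _ _).2 fun x hx =>
          Set.piecewise_eq_of_notMem _ _ _ fun h => hpoo x h q hq hx
      have e₅ : ∀ q ∈ l, (s q).readIn ((s p).outs.piecewise k' w) = (s q).readIn w := fun q hq =>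
        ((s q).readIn_eq_iff _ _).2 fun x hx =>
          Set.piecewise_eq_of_notMem _ _ _ fun h => hpo x h q hq hx
      have e₆ : ∀ q ∈ l, (s q).readIn n = (s q).readIn k' := fun q hq =>
        ((s q).readIn_eq_iff _ _).2 fun x hx =>
          (h₁ x (fun h => hpi x h q hq hx) fun h => hpo x h q hq hx).symm
      rw [List.map_cons, List.prod_cons, List.map_cons, List.prod_cons, e₁, e₂, e₃,
        List.map_congr_left (f := fun q => U q ((s q).readOut ((s p).outs.piecewise k' w)) _)
          fun q hq => by rw [e₄ q hq, e₅ q hq],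
        List.map_congr_left (f := fun q => star (U q ((s q).readOut k) ((s q).readIn n)))
          fun q hq => by rw [e₆ q hq]]
      ring

end Network

/-! ### Circuits of unitary gates -/

/-- Every finite set of elements of a partial order can be listed so that no element is below a later
one. -/
theorem Finset.exists_list_antitone {P : Type*} [PartialOrder P] [DecidableEq P] (D : Finset P) :
    ∃ l : List P, (∀ p, p ∈ l ↔ p ∈ D) ∧ l.Pairwise fun p q => ¬ p ≤ q := by
  induction D using Finset.strongInduction with
  | H D ih =>
    rcases D.eq_empty_or_nonempty with rfl | hD
    · exact ⟨[], by simp, List.Pairwise.nil⟩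
    · obtain ⟨m, hm⟩ := D.exists_maximal hD
      obtain ⟨l, hl, hl'⟩ := ih (D.erase m) (Finset.erase_ssubset hm.1)
      refine ⟨m :: l, fun p => ?_, List.pairwise_cons.2 ⟨fun q hq hmq => ?_, hl'⟩⟩
      · rw [List.mem_cons, hl, Finset.mem_erase]
        by_cases h : p = m
        · simp [h, hm.1]
        · simp [h]
      · have hq' := Finset.mem_erase.1 ((hl q).1 hq)
        exact hq'.1 (le_antisymm (hm.2 hq'.2 hmq) hmq)

namespace QuantumCircuit

universe u v

variable {A B : Type*} [Fintype A] [DecidableEq A] [Fintype B] [DecidableEq B]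
    {HA : A → Type u} {HB : B → Type v} [∀ x, Fintype (HA x)] [∀ x, DecidableEq (HA x)]
    [∀ y, Fintype (HB y)] [∀ y, DecidableEq (HB y)] (C : QuantumCircuit HA HB)

/-- The wires of a circuit: the inputs, the internal wires, and the outputs. -/
abbrev AllWires : Type _ := A ⊕ C.Wire ⊕ B

/-- The basis of the system on each wire of a circuit. -/
def WireBasis : C.AllWires → Type (max u v)
  | .inl x => ULift.{v} (HA x)
  | .inr (.inl e) => ULift.{max u v} (C.Z e)
  | .inr (.inr y) => ULift.{u} (HB y)

noncomputable instance (l : C.AllWires) : Fintype (C.WireBasis l) :=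
  match l with
  | .inl x => inferInstanceAs (Fintype (ULift (HA x)))
  | .inr (.inl e) => inferInstanceAs (Fintype (ULift (C.Z e)))
  | .inr (.inr y) => inferInstanceAs (Fintype (ULift (HB y)))

noncomputable instance (l : C.AllWires) : DecidableEq (C.WireBasis l) := Classical.decEq _

variable {C} in
/-- The labels of the inputs. -/
def inputLabel (k : ∀ l, C.WireBasis l) (x : A) : HA x := ULift.down (k (.inl x))

variable {C} in
/-- The labels of the internal wires. -/
def wireLabel (k : ∀ l, C.WireBasis l) (e : C.Wire) : C.Z e := ULift.down (k (.inr (.inl e)))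

variable {C} in
/-- The labels of the outputs. -/
def outputLabel (k : ∀ l, C.WireBasis l) (y : B) : HB y := ULift.down (k (.inr (.inr y)))

/-- The joint label of all wires with given labels of the inputs, internal wires, and outputs. -/
def joinLabels (x : ∀ a, HA a) (z : ∀ e, C.Z e) (y : ∀ b, HB b) : ∀ l, C.WireBasis l
  | .inl a => ULift.up (x a)
  | .inr (.inl e) => ULift.up (z e)
  | .inr (.inr b) => ULift.up (y b)

/-- The box that a wire enters, if any. -/
def target : C.AllWires → Option C.Box
  | .inl x => some (C.lam x)
  | .inr (.inl e) => some e.tgt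
  | .inr (.inr _) => none

/-- The box that a wire leaves, if any. -/
def source : C.AllWires → Option C.Box
  | .inl _ => none
  | .inr (.inl e) => some e.src
  | .inr (.inr y) => some (C.mu y)

variable {C} in
theorem lt_of_source_of_target {l : C.AllWires} {p q : C.Box} (hp : C.source l = some p)
    (hq : C.target l = some q) : p < q := by
  match l with
  | .inl x => simp [source] at hp
  | .inr (.inl e) =>
    simp only [source, target, Option.some.injEq] at hp hq
    subst hp hq
    exact e.covBy.lt
  | .inr (.inr y) => simp [target] at hq

/-- The gate of the box `p` among all wires of the circuit. -/
noncomputable def slot (p : C.Box) :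
    GateSlot C.WireBasis (C.GateIn HA C.Z p) (C.GateOut HB C.Z p) where
  ins := {l | C.target l = some p}
  outs := {l | C.source l = some p}
  disjoint := Set.disjoint_left.2 fun _ h h' => (lt_of_source_of_target h' h).false
  readIn k := C.inAt (inputLabel k) (wireLabel k) p
  readOut k := C.outAt (wireLabel k) (outputLabel k) p
  readIn_eq_iff k m := by
    refine ⟨fun h l hl => ?_, fun h => ?_⟩
    · obtain ⟨h₁, h₂⟩ := Prod.ext_iff.1 h
      match l with
      | .inl x => exact ULift.ext _ _ (congrFun h₁ ⟨x, Option.some.inj hl⟩)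
      | .inr (.inl e) => exact ULift.ext _ _ (congrFun h₂ ⟨e, Option.some.inj hl⟩)
      | .inr (.inr y) => cases hl
    · refine Prod.ext (funext fun x => ?_) (funext fun e => ?_)
      · exact congrArg ULift.down (h (.inl x.1) (congrArg some x.2))
      · exact congrArg ULift.down (h (.inr (.inl e.1)) (congrArg some e.2))
  readOut_eq_iff k m := by
    refine ⟨fun h l hl => ?_, fun h => ?_⟩
    · obtain ⟨h₁, h₂⟩ := Prod.ext_iff.1 h
      match l with
      | .inl x => cases hl
      | .inr (.inl e) => exact ULift.ext _ _ (congrFun h₁ ⟨e, Option.some.inj hl⟩)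
      | .inr (.inr y) => exact ULift.ext _ _ (congrFun h₂ ⟨y, Option.some.inj hl⟩)
    · refine Prod.ext (funext fun e => ?_) (funext fun y => ?_)
      · exact congrArg ULift.down (h (.inr (.inl e.1)) (congrArg some e.2))
      · exact congrArg ULift.down (h (.inr (.inr y.1)) (congrArg some y.2))
  exists_write k i o := by
    refine ⟨C.joinLabels (fun x => if h : C.lam x = p then i.1 ⟨x, h⟩ else inputLabel k x)
      (fun e => if h : e.tgt = p then i.2 ⟨e, h⟩ else if h : e.src = p then o.1 ⟨e, h⟩ else
        wireLabel k e)
      (fun y => if h : C.mu y = p then o.2 ⟨y, h⟩ else outputLabel k y), ?_, ?_, ?_⟩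
    · refine Prod.ext (funext fun x => ?_) (funext fun e => ?_)
      · exact dif_pos x.2
      · exact dif_pos e.2
    · refine Prod.ext (funext fun e => ?_) (funext fun y => ?_)
      · have : e.1.tgt ≠ p := fun h => (e.1.covBy.lt.trans_eq (h.trans e.2.symm)).false
        exact (dif_neg this).trans (dif_pos e.2)
      · exact dif_pos y.2
    · intro l hi ho
      match l with
      | .inl x => exact congrArg ULift.up (dif_neg fun h => hi (congrArg some h))
      | .inr (.inl e) =>
        exact congrArg ULift.up ((dif_neg fun h => hi (congrArg some h)).trans
          (dif_neg fun h => ho (congrArg some h)))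
      | .inr (.inr y) => exact congrArg ULift.up (dif_neg fun h => ho (congrArg some h))

variable (U : ∀ p, Matrix (C.GateOut HB C.Z p) (C.GateIn HA C.Z p) ℂ)

/-- The matrix that a circuit of matrices composes to. -/
noncomputable def amplitude (y : ∀ b, HB b) (x : ∀ a, HA a) : ℂ :=
  ∑ z : ∀ e, C.Z e, ∏ p, U p (C.outAt z y p) (C.inAt x z p)

theorem coeff_channel (hU : ∀ p, C.gate p = conjBy (U p)) (y y' : ∀ b, HB b) (x x' : ∀ a, HA a) :
    coeff C.channel y y' x x' = C.amplitude U y x * star (C.amplitude U y' x') := by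
  rw [channel, coeff_ofCoeff, amplitude, amplitude, star_sum, Finset.sum_mul_sum]
  refine Finset.sum_congr rfl fun z _ => Finset.sum_congr rfl fun z' _ => ?_
  simp only [hU, coeff_conjBy, Finset.prod_mul_distrib, star_prod]

/-- The contraction of all gates is the matrix that the circuit composes to. -/
theorem contraction_eq_amplitude {l : List C.Box} (hl : l.Nodup) (hmem : ∀ p, p ∈ l)
    (k' k : ∀ l, C.WireBasis l) :
    contraction C.slot U l k' k = C.amplitude U (outputLabel k') (inputLabel k) := by
  classical
  have hprod : ∀ f : C.Box → ℂ, (l.map f).prod = ∏ p, f p := fun f => by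
    rw [← List.prod_toFinset f hl]
    congr 1
    ext p
    simp [hmem]
  simp only [contraction, hprod, amplitude]
  rw [← Finset.sum_filter]
  refine Finset.sum_nbij' (fun w => wireLabel w)
    (fun z => C.joinLabels (inputLabel k) z (outputLabel k')) ?_ ?_ ?_ ?_ ?_
  · intro w _; exact Finset.mem_univ _
  · intro z _
    refine Finset.mem_filter.2 ⟨Finset.mem_univ _, fun l hl => ?_, fun l hl => ?_⟩
    · match l with
      | .inl x => rfl
      | .inr (.inl e) => exact absurd rfl (hl e.src (hmem _))
      | .inr (.inr y) => exact absurd rfl (hl (C.mu y) (hmem _))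
    · match l with
      | .inl x => exact absurd rfl (hl (C.lam x) (hmem _))
      | .inr (.inl e) => exact absurd rfl (hl e.tgt (hmem _))
      | .inr (.inr y) => rfl
  · intro w hw
    obtain ⟨h₁, h₂⟩ := (Finset.mem_filter.1 hw).2
    funext l
    match l with
    | .inl x => exact (h₁ (.inl x) fun p _ h => by cases h).symm
    | .inr (.inl e) => rfl
    | .inr (.inr y) => exact (h₂ (.inr (.inr y)) fun p _ h => by cases h).symm
  · intro z _; rfl
  · intro w hw
    obtain ⟨h₁, h₂⟩ := (Finset.mem_filter.1 hw).2
    have e₁ : inputLabel w = inputLabel k := funext fun x =>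
      congrArg ULift.down (h₁ (.inl x) fun p _ h => by cases h)
    have e₂ : outputLabel w = outputLabel k' := funext fun y =>
      congrArg ULift.down (h₂ (.inr (.inr y)) fun p _ h => by cases h)
    refine Finset.prod_congr rfl fun p _ => ?_
    rw [← e₁, ← e₂]
    rfl

/-- The product of the exchange operators of the gates in a list. -/
noncomputable def exchangeProd (l : List C.Box) : Op (∀ l, C.WireBasis l) :=
  (l.map fun p => exchange (C.slot p) (U p)).prod

theorem exchangeProd_append (l l' : List C.Box) :
    C.exchangeProd U (l ++ l') = C.exchangeProd U l * C.exchangeProd U l' := by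
  simp [exchangeProd]

variable {U} in
theorem exchangeProd_unitary (h₁ : ∀ p, (U p)ᴴ * U p = 1) (h₂ : ∀ p, U p * (U p)ᴴ = 1)
    (l : List C.Box) : (C.exchangeProd U l)ᴴ * C.exchangeProd U l = 1 := by
  induction l with
  | nil => simp [exchangeProd]
  | cons p l ih =>
    rw [← List.singleton_append, exchangeProd_append, Matrix.conjTranspose_mul]
    have : (C.exchangeProd U [p])ᴴ * C.exchangeProd U [p] = 1 := by
      rw [exchangeProd, List.map_singleton, List.prod_singleton, conjTranspose_exchange,
        exchange_mul_self _ _ (h₁ p) (h₂ p)]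
    rw [Matrix.mul_assoc, ← Matrix.mul_assoc _ (C.exchangeProd U [p]), this, Matrix.one_mul, ih]

/-- The wires that enter or leave a box in `D`. -/
def touching (D : Set C.Box) : Set C.AllWires :=
  {l | (∃ p ∈ D, C.target l = some p) ∨ ∃ p ∈ D, C.source l = some p}

theorem actsOn_exchangeProd {D : Set C.Box} {l : List C.Box} (hl : ∀ p ∈ l, p ∈ D) :
    ActsOn (C.touching D) (C.exchangeProd U l) := by
  refine actsOn_list_prod fun M hM => ?_
  obtain ⟨p, hp, rfl⟩ := List.mem_map.1 hM
  refine (actsOn_exchange _ _).mono ?_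
  rintro x (hx | hx)
  · exact Or.inl ⟨p, hl p hp, hx⟩
  · exact Or.inr ⟨p, hl p hp, hx⟩

/-- If the circuit composes to amplitudes that vanish at given labels of inputs and outputs, then so
does the product of all exchange operators. -/
theorem exchangeProd_apply_eq_zero {l : List C.Box} (hl : l.Pairwise fun p q => ¬ p ≤ q)
    (hmem : ∀ p, p ∈ l) {k' k : ∀ l, C.WireBasis l}
    (h : C.amplitude U (outputLabel k') (inputLabel k) = 0) : C.exchangeProd U l k' k = 0 := by
  have hnodup : l.Nodup := hl.imp fun h h' => h h'.le
  rw [exchangeProd, exchange_prod_apply, contraction_eq_amplitude C U hnodup hmem, h, zero_mul]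
  refine hl.imp fun {p q} hpq => ⟨?_, ?_, ?_⟩
  · exact Set.disjoint_left.2 fun x hp hq => hpq (lt_of_source_of_target hp hq).le
  · exact Set.disjoint_left.2 fun x hp hq => hpq (Option.some.inj (hp.symm.trans hq)).le
  · exact Set.disjoint_left.2 fun x hp hq => hpq (Option.some.inj (hp.symm.trans hq)).le

end QuantumCircuit

/-! ### An observable with two disjoint carriers -/

/-- If `P Q F` intertwines `Z'` with `Z Y`, where `Z'` commutes with `P` and `Z` with `F`, then `F`
carries `Y` to an operator made from `Z`, `Z'` and `Q` only. -/
theorem conj_eq_of_intertwine {n : Type*} [Fintype n] [DecidableEq n] {P Q F Z' Z Y : Op n}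
    (hP : Pᴴ * P = 1) (hQ : Qᴴ * Q = 1) (hF : Fᴴ * F = 1) (hZ : Z * Z = 1)
    (h : Z' * (P * Q * F) = P * Q * F * (Z * Y)) (hZP : Commute Z' P) (hZF : Commute Z F) :
    F * Y * Fᴴ = Z * (Qᴴ * Z' * Q) := by
  have hF' : F * Fᴴ = 1 := mul_eq_one_comm.1 hF
  have e : Z' * (P * Q * F) = P * (Z' * Q * F) := by
    rw [Matrix.mul_assoc P, ← Matrix.mul_assoc Z', hZP.eq]
    simp only [Matrix.mul_assoc]
  have e' : P * Q * F * (Z * Y) = P * (Q * Z * F * Y) := by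
    calc P * Q * F * (Z * Y) = P * (Q * (F * Z) * Y) := by simp only [Matrix.mul_assoc]
      _ = P * (Q * Z * F * Y) := by rw [← hZF.eq]; simp only [Matrix.mul_assoc]
  have h₁ : Z' * Q * F = Q * Z * F * Y := by
    have := congrArg (Pᴴ * ·) (e.symm.trans (h.trans e'))
    simpa only [← Matrix.mul_assoc, hP, Matrix.one_mul] using this
  calc F * Y * Fᴴ = Z * (Qᴴ * Q) * Z * (F * Y * Fᴴ) := by
        rw [hQ, Matrix.mul_one, hZ, Matrix.one_mul]
    _ = Z * Qᴴ * (Q * Z * F * Y) * Fᴴ := by simp only [Matrix.mul_assoc]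
    _ = Z * (Qᴴ * Z' * Q) * (F * Fᴴ) := by rw [← h₁]; simp only [Matrix.mul_assoc]
    _ = Z * (Qᴴ * Z' * Q) := by rw [hF', Matrix.mul_one]

namespace QuantumCircuit

universe u v

variable {A B : Type*} [Fintype A] [DecidableEq A] [Fintype B] [DecidableEq B]
    {HA : A → Type u} {HB : B → Type v} [∀ x, Fintype (HA x)] [∀ x, DecidableEq (HA x)]
    [∀ y, Fintype (HB y)] [∀ y, DecidableEq (HB y)] (C : QuantumCircuit HA HB)

variable {C} in
theorem disjoint_touching {D D' : Set C.Box} (hD : IsLowerSet D) (hD' : IsLowerSet D') :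
    Disjoint (C.touching (D \ D')) (C.touching (D' \ D)) := by
  refine Set.disjoint_left.2 ?_
  rintro l (⟨p, hp, hl⟩ | ⟨p, hp, hl⟩) (⟨q, hq, hl'⟩ | ⟨q, hq, hl'⟩)
  · exact hp.2 (Option.some.inj (hl.symm.trans hl') ▸ hq.1)
  · exact hq.2 (hD (lt_of_source_of_target hl' hl).le hp.1)
  · exact hp.2 (hD' (lt_of_source_of_target hl hl').le hq.1)
  · exact hp.2 (Option.some.inj (hl.symm.trans hl') ▸ hq.1)

variable {C} {U : ∀ p, Matrix (C.GateOut HB C.Z p) (C.GateIn HA C.Z p) ℂ}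

/-- The diagonal operator given by a function of an input label. -/
noncomputable def inputDiag (C : QuantumCircuit HA HB) (x : A) (g : HA x → ℂ) :
    Op (∀ l, C.WireBasis l) :=
  Matrix.diagonal fun k => g (inputLabel k x)

/-- The diagonal operator given by a function of an output label. -/
noncomputable def outputDiag (C : QuantumCircuit HA HB) (y : B) (h : HB y → ℂ) :
    Op (∀ l, C.WireBasis l) :=
  Matrix.diagonal fun k => h (outputLabel k y)

theorem actsOn_inputDiag (x : A) (g : HA x → ℂ) : ActsOn {.inl x} (C.inputDiag x g) :=
  actsOn_diagonal (H := C.WireBasis) (.inl x) fun s => g s.down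

theorem actsOn_outputDiag (y : B) (h : HB y → ℂ) : ActsOn {.inr (.inr y)} (C.outputDiag y h) :=
  actsOn_diagonal (H := C.WireBasis) (.inr (.inr y)) fun s => h s.down

theorem commute_inputDiag {D : Set C.Box} {M : Op (∀ l, C.WireBasis l)}
    (hM : ActsOn (C.touching D) M) {x : A} (hx : C.lam x ∉ D) (g : HA x → ℂ) :
    Commute (C.inputDiag x g) M := by
  refine hM.commute_diagonal (l := .inl x) ?_ fun s => g s.down
  rintro (⟨p, hp, h⟩ | ⟨p, hp, h⟩)
  · exact hx (Option.some.inj h ▸ hp)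
  · cases h

theorem commute_outputDiag {D : Set C.Box} {M : Op (∀ l, C.WireBasis l)}
    (hM : ActsOn (C.touching D) M) {y : B} (hy : C.mu y ∉ D) (h : HB y → ℂ) :
    Commute (C.outputDiag y h) M := by
  refine hM.commute_diagonal (l := .inr (.inr y)) ?_ fun s => h s.down
  rintro (⟨p, hp, h⟩ | ⟨p, hp, h⟩)
  · cases h
  · exact hy (Option.some.inj h ▸ hp)

theorem inputDiag_mul_self {x : A} {g : HA x → ℂ} (hg : ∀ s, g s * g s = 1) :
    C.inputDiag x g * C.inputDiag x g = 1 := by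
  rw [inputDiag, Matrix.diagonal_mul_diagonal]
  simp only [hg, Matrix.diagonal_one]

/-- In a circuit of unitary gates, let an output `y₁` determine the product of a sign `g₁` of the input
`x₁` and a function `g₂` of the input `x₂`, and let an output `y₃` determine the product of a sign `g₃`
of the input `x₃` and the same function `g₂`. If there is no path from `x₁` to `y₃` and none from `x₃`
to `y₁`, then `g₂` is constant: the common past of `y₁` and `y₃` carries `g₂` to an observable of the
wires that lead on to `y₁` only and also to an observable of the wires that lead on to `y₃` only. -/
theorem constant_of_copied (h₁ : ∀ p, (U p)ᴴ * U p = 1) (h₂ : ∀ p, U p * (U p)ᴴ = 1)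
    {x₁ x₂ x₃ : A} {y₁ y₃ : B} (h11 : C.lam x₁ ≤ C.mu y₁) (h33 : C.lam x₃ ≤ C.mu y₃)
    (h13 : ¬ C.lam x₁ ≤ C.mu y₃) (h31 : ¬ C.lam x₃ ≤ C.mu y₁)
    {g₁ : HA x₁ → ℂ} {g₂ : HA x₂ → ℂ} {g₃ : HA x₃ → ℂ} {f₁ : HB y₁ → ℂ} {f₃ : HB y₃ → ℂ}
    (hg₁ : ∀ s, g₁ s * g₁ s = 1) (hg₃ : ∀ s, g₃ s * g₃ s = 1)
    (hf₁ : ∀ y x, C.amplitude U y x ≠ 0 → f₁ (y y₁) = g₁ (x x₁) * g₂ (x x₂))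
    (hf₃ : ∀ y x, C.amplitude U y x ≠ 0 → f₃ (y y₃) = g₃ (x x₃) * g₂ (x x₂))
    (k m : ∀ l, C.WireBasis l) : g₂ (inputLabel k x₂) = g₂ (inputLabel m x₂) := by
  classical
  let D₁ : Set C.Box := Set.Iic (C.mu y₁)
  let D₃ : Set C.Box := Set.Iic (C.mu y₃)
  have hD₁ : IsLowerSet D₁ := isLowerSet_Iic _
  have hD₃ : IsLowerSet D₃ := isLowerSet_Iic _
  -- The boxes in four layers: the common past `D₁ ∩ D₃` acts first, then `D₁ \ D₃` and `D₃ \ D₁`,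
  -- then the rest.
  obtain ⟨l₀, m₀, p₀⟩ := (D₁ ∩ D₃).toFinset.exists_list_antitone
  obtain ⟨l₁, m₁, p₁⟩ := (D₁ \ D₃).toFinset.exists_list_antitone
  obtain ⟨l₃, m₃, p₃⟩ := (D₃ \ D₁).toFinset.exists_list_antitone
  obtain ⟨l₄, m₄, p₄⟩ := ((D₁ ∪ D₃)ᶜ).toFinset.exists_list_antitone
  simp only [Set.mem_toFinset] at m₀ m₁ m₃ m₄
  have hpair : (l₄ ++ (l₃ ++ (l₁ ++ l₀))).Pairwise fun p q => ¬ p ≤ q := by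
    simp only [List.pairwise_append, List.mem_append, m₀, m₁, m₃, m₄]
    refine ⟨p₄, ⟨p₃, ⟨p₁, p₀, ?_⟩, ?_⟩, ?_⟩
    · exact fun p hp q hq hpq => hp.2 (hD₃ hpq hq.2)
    · rintro p hp q (hq | hq) hpq
      · exact hp.2 (hD₁ hpq hq.1)
      · exact hp.2 (hD₁ hpq hq.1)
    · rintro p hp q (hq | hq | hq) hpq
      · exact hp (Or.inr (hD₃ hpq hq.1))
      · exact hp (Or.inl (hD₁ hpq hq.1))
      · exact hp (Or.inl (hD₁ hpq hq.1))
  have hmem : ∀ p, p ∈ l₄ ++ (l₃ ++ (l₁ ++ l₀)) := by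
    intro p
    simp only [List.mem_append, m₀, m₁, m₃, m₄, Set.mem_compl_iff, Set.mem_union, Set.mem_sdiff,
      Set.mem_inter_iff]
    tauto
  set S₀ := C.exchangeProd U l₀ with hS₀
  set S₁ := C.exchangeProd U l₁ with hS₁
  set S₃ := C.exchangeProd U l₃ with hS₃
  set S₄ := C.exchangeProd U l₄ with hS₄
  have u₀ : S₀ᴴ * S₀ = 1 := exchangeProd_unitary C h₁ h₂ l₀
  have u₁ : S₁ᴴ * S₁ = 1 := exchangeProd_unitary C h₁ h₂ l₁
  have u₃ : S₃ᴴ * S₃ = 1 := exchangeProd_unitary C h₁ h₂ l₃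
  have u₄ : S₄ᴴ * S₄ = 1 := exchangeProd_unitary C h₁ h₂ l₄
  have hmul : ∀ {P Q : Op (∀ l, C.WireBasis l)}, Pᴴ * P = 1 → Qᴴ * Q = 1 →
      (P * Q)ᴴ * (P * Q) = 1 := by
    intro P Q hP hQ
    rw [Matrix.conjTranspose_mul, Matrix.mul_assoc, ← Matrix.mul_assoc _ P, hP, Matrix.one_mul, hQ]
  have a₀ : ActsOn (C.touching (D₁ ∩ D₃)) S₀ := C.actsOn_exchangeProd U fun p hp => (m₀ p).1 hp
  have a₁ : ActsOn (C.touching (D₁ \ D₃)) S₁ := C.actsOn_exchangeProd U fun p hp => (m₁ p).1 hp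
  have a₃ : ActsOn (C.touching (D₃ \ D₁)) S₃ := C.actsOn_exchangeProd U fun p hp => (m₃ p).1 hp
  have a₄ : ActsOn (C.touching (D₁ ∪ D₃)ᶜ) S₄ := C.actsOn_exchangeProd U fun p hp => (m₄ p).1 hp
  have hS : C.exchangeProd U (l₄ ++ (l₃ ++ (l₁ ++ l₀))) = S₄ * (S₃ * (S₁ * S₀)) := by
    simp only [exchangeProd_append, hS₀, hS₁, hS₃, hS₄]
  have hx₁ : C.lam x₁ ∈ D₁ \ D₃ := ⟨h11, h13⟩
  have hx₃ : C.lam x₃ ∈ D₃ \ D₁ := ⟨h33, h31⟩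
  have hy₁ : C.mu y₁ ∈ D₁ \ D₃ := ⟨le_refl _, fun h => h13 (h11.trans h)⟩
  have hy₃ : C.mu y₃ ∈ D₃ \ D₁ := ⟨le_refl _, fun h => h31 (h33.trans h)⟩
  have hint : ∀ {x : A} {y : B} {g : HA x → ℂ} {f : HB y → ℂ},
      (∀ y' x', C.amplitude U y' x' ≠ 0 → f (y' y) = g (x' x) * g₂ (x' x₂)) →
      C.outputDiag y f * (S₄ * (S₃ * (S₁ * S₀)))
        = S₄ * (S₃ * (S₁ * S₀)) * (C.inputDiag x g * C.inputDiag x₂ g₂) := by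
    intro x y g f hf
    rw [← hS]
    ext k' k
    rw [outputDiag, inputDiag, inputDiag, Matrix.diagonal_mul_diagonal, Matrix.diagonal_mul,
      Matrix.mul_diagonal]
    by_cases h0 : C.amplitude U (outputLabel k') (inputLabel k) = 0
    · rw [C.exchangeProd_apply_eq_zero U hpair hmem h0, mul_zero, zero_mul]
    · rw [hf _ _ h0, mul_comm]
  have i₁ : S₀ * C.inputDiag x₂ g₂ * S₀ᴴ = C.inputDiag x₁ g₁ * (S₁ᴴ * C.outputDiag y₁ f₁ * S₁) := by
    refine conj_eq_of_intertwine (hmul u₄ u₃) u₁ u₀ (inputDiag_mul_self hg₁) ?_ ?_ ?_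
    · simpa only [Matrix.mul_assoc] using hint hf₁
    · exact (commute_outputDiag a₄ (fun h => h (Or.inl hy₁.1)) _).mul_right
        (commute_outputDiag a₃ (fun h => h.2 hy₁.1) _)
    · exact commute_inputDiag a₀ (fun h => hx₁.2 h.2) _
  have i₃ : S₁ * S₀ * C.inputDiag x₂ g₂ * (S₁ * S₀)ᴴ
      = C.inputDiag x₃ g₃ * (S₃ᴴ * C.outputDiag y₃ f₃ * S₃) := by
    refine conj_eq_of_intertwine u₄ u₃ (hmul u₁ u₀) (inputDiag_mul_self hg₃) ?_ ?_ ?_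
    · simpa only [Matrix.mul_assoc] using hint hf₃
    · exact commute_outputDiag a₄ (fun h => h (Or.inr hy₃.1)) _
    · exact (commute_inputDiag a₁ (fun h => hx₃.2 h.1) _).mul_right
        (commute_inputDiag a₀ (fun h => hx₃.2 h.1) _)
  have hin : ∀ {D : Set C.Box} {x : A} (g : HA x → ℂ), C.lam x ∈ D →
      ActsOn (C.touching D) (C.inputDiag x g) := fun g hx => (actsOn_inputDiag _ g).mono
    (Set.singleton_subset_iff.2 (Or.inl ⟨_, hx, rfl⟩))
  have hout : ∀ {D : Set C.Box} {y : B} (f : HB y → ℂ), C.mu y ∈ D →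
      ActsOn (C.touching D) (C.outputDiag y f) := fun f hy => (actsOn_outputDiag _ f).mono
    (Set.singleton_subset_iff.2 (Or.inr ⟨_, hy, rfl⟩))
  set N := S₁ * S₀ * C.inputDiag x₂ g₂ * (S₁ * S₀)ᴴ with hN
  have n₁ : ActsOn (C.touching (D₁ \ D₃)) N := by
    have : N = S₁ * (C.inputDiag x₁ g₁ * (S₁ᴴ * C.outputDiag y₁ f₁ * S₁)) * S₁ᴴ := by
      rw [← i₁, hN, Matrix.conjTranspose_mul]
      simp only [Matrix.mul_assoc]
    rw [this]
    exact (a₁.mul ((hin g₁ hx₁).mul ((a₁.conjTranspose.mul (hout f₁ hy₁)).mul a₁))).mul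
      a₁.conjTranspose
  have n₃ : ActsOn (C.touching (D₃ \ D₁)) N := by
    rw [i₃]
    exact (hin g₃ hx₃).mul ((a₃.conjTranspose.mul (hout f₃ hy₃)).mul a₃)
  obtain ⟨hoff, hdiag⟩ := n₁.apply_of_disjoint n₃ (disjoint_touching hD₁ hD₃)
  have hscal : N = N k k • (1 : Op (∀ l, C.WireBasis l)) := by
    ext i j
    by_cases hij : i = j
    · rw [hij, Matrix.smul_apply, Matrix.one_apply_eq, smul_eq_mul, mul_one, hdiag j k]
    · rw [Matrix.smul_apply, Matrix.one_apply_ne hij, smul_zero, hoff i j hij]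
  have hF := hmul u₁ u₀
  have hZ : C.inputDiag x₂ g₂ = N k k • (1 : Op (∀ l, C.WireBasis l)) := by
    calc C.inputDiag x₂ g₂ = ((S₁ * S₀)ᴴ * (S₁ * S₀)) * C.inputDiag x₂ g₂ *
          ((S₁ * S₀)ᴴ * (S₁ * S₀)) := by rw [hF, Matrix.one_mul, Matrix.mul_one]
      _ = (S₁ * S₀)ᴴ * N * (S₁ * S₀) := by rw [hN]; simp only [Matrix.mul_assoc]
      _ = N k k • (1 : Op (∀ l, C.WireBasis l)) := by
        rw [hscal, Matrix.mul_smul, Matrix.smul_mul, Matrix.mul_one, hF]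
        simp
  have hval : ∀ n, g₂ (inputLabel n x₂) = N k k := fun n => by
    have := congrFun (congrFun hZ n) n
    rwa [inputDiag, Matrix.diagonal_apply_eq, Matrix.smul_apply, Matrix.one_apply_eq, smul_eq_mul,
      mul_one] at this
  rw [hval, hval]

/-- The gates of a unitary circuit are given by unitary matrices. -/
theorem IsUnitary.exists_matrices [∀ x, Nonempty (HA x)] (hC : C.IsUnitary) :
    ∃ U : ∀ p, Matrix (C.GateOut HB C.Z p) (C.GateIn HA C.Z p) ℂ,
      (∀ p, (U p)ᴴ * U p = 1) ∧ (∀ p, U p * (U p)ᴴ = 1) ∧ ∀ p, C.gate p = conjBy (U p) := by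
  choose U h₁ h₂ hU using fun p => (hC p).exists_conjBy
  exact ⟨U, h₁, h₂, hU⟩

end QuantumCircuit

/-! ### The unitary `U₃ ⊗ V` has no unitary circuit -/

/-- The sign `(-1)^s`, the eigenvalue of the Pauli operator `Z` on the basis vector `s`. -/
def pauliSign (s : Fin 2) : ℂ := if s = 0 then 1 else -1

theorem pauliSign_mul_self (s : Fin 2) : pauliSign s * pauliSign s = 1 := by
  fin_cases s <;> simp [pauliSign]

theorem pauliSign_add (s t : Fin 2) : pauliSign (s + t) = pauliSign s * pauliSign t := by
  fin_cases s <;> fin_cases t <;> simp [pauliSign]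

theorem tensorMatrix_ne_zero
    {A B : Type*} [DecidableEq A] [DecidableEq B] {HA : A → Type*} {HB : B → Type*}
    {a : Fin 3 → A} {b : Fin 3 → B} {v : Matrix (∀ y, HB y) (∀ x, HA x) ℂ}
    {y : ∀ j, WithQubits b HB j} {x : ∀ i, WithQubits a HA i} (h : tensorMatrix a b v y x ≠ 0) :
    (splitQubits b HB y).1 = copyPerm (splitQubits a HA x).1 := by
  by_contra h'
  refine h ?_
  simp [tensorMatrix, copyMatrix, h']

theorem not_exists_unitary_circuit
    {A B : Type*} [Fintype A] [DecidableEq A] [Fintype B] [DecidableEq B]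
    {HA : A → Type*} {HB : B → Type*}
    [∀ x, Fintype (HA x)] [∀ x, DecidableEq (HA x)] [∀ x, Nonempty (HA x)]
    [∀ y, Fintype (HB y)] [∀ y, DecidableEq (HB y)] [∀ y, Nonempty (HB y)]
    {G : A → B → Prop} {a : Fin 3 → A} {b : Fin 3 → B} (hG : RestrictsToC3 G a b)
    (v : Matrix (∀ y, HB y) (∀ x, HA x) ℂ) :
    ¬ ∃ C : QuantumCircuit (WithQubits a HA) (WithQubits b HB),
      C.IsUnitary ∧ C.connectivity = G ∧ C.IsDecompositionOf (tensorU3 a b (conjBy v)) := by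
  rintro ⟨C, hC, rfl, hdec⟩
  obtain ⟨U, h₁, h₂, hU⟩ := hC.exists_matrices
  have hamp : ∀ y x, C.amplitude U y x ≠ 0 →
      (splitQubits b HB y).1 = copyPerm (splitQubits a HA x).1 := by
    intro y x h
    refine tensorMatrix_ne_zero (v := v) fun h0 => h ?_
    have e := C.coeff_channel U hU y y x x
    rw [hdec, tensorU3_conjBy, coeff_conjBy, h0, zero_mul, eq_comm, mul_eq_zero, star_eq_zero,
      or_self] at e
    exact e
  have hpath : ∀ i j, C.lam (a i) ≤ C.mu (b j) ↔ relC3 i j := hG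
  let x : ∀ i, WithQubits a HA i := fun i => Classical.arbitrary _
  let z : ∀ e, C.Z e := fun e => Classical.arbitrary _
  let y : ∀ j, WithQubits b HB j := fun j => Classical.arbitrary _
  let x' (s : Fin 2) : ∀ i, WithQubits a HA i := fun i => (fun _ => s, (x i).2)
  have h := QuantumCircuit.constant_of_copied (C := C) h₁ h₂
    (x₁ := a 0) (x₂ := a 1) (x₃ := a 2) (y₁ := b 0) (y₃ := b 2)
    ((hpath 0 0).2 (by simp [relC3])) ((hpath 2 2).2 (by simp [relC3]))
    (fun h => by simpa [relC3] using (hpath 0 2).1 h)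
    (fun h => by simpa [relC3] using (hpath 2 0).1 h)
    (g₁ := fun s => pauliSign (s.1 ⟨0, rfl⟩)) (g₂ := fun s => pauliSign (s.1 ⟨1, rfl⟩))
    (g₃ := fun s => pauliSign (s.1 ⟨2, rfl⟩)) (f₁ := fun s => pauliSign (s.1 ⟨0, rfl⟩))
    (f₃ := fun s => pauliSign (s.1 ⟨2, rfl⟩))
    (fun s => pauliSign_mul_self _) (fun s => pauliSign_mul_self _)
    (fun y x h => by
      rw [← pauliSign_add]
      exact congrArg pauliSign (congrFun (hamp y x h) 0))
    (fun y x h => by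
      rw [← pauliSign_add]
      exact congrArg pauliSign (congrFun (hamp y x h) 2))
    (C.joinLabels (x' 0) z y) (C.joinLabels (x' 1) z y)
  have h' : pauliSign 0 = pauliSign 1 := h
  norm_num [pauliSign] at h'
theorem proposition4
    {A B : Type*} [Fintype A] [DecidableEq A] [Fintype B] [DecidableEq B]
    (HA : A → Type*) (HB : B → Type*)
    [∀ x, Fintype (HA x)] [∀ x, DecidableEq (HA x)] [∀ x, Nonempty (HA x)]
    [∀ y, Fintype (HB y)] [∀ y, DecidableEq (HB y)] [∀ y, Nonempty (HB y)]
    (G : A → B → Prop) (a : Fin 3 → A) (b : Fin 3 → B) (hG : RestrictsToC3 G a b)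
    (V : Op (∀ x, HA x) →ₗ[ℂ] Op (∀ y, HB y)) (hV : IsUnitaryChannel V)
    (hGV : causalStructure V = G) :
    IsUnitaryChannel (tensorU3 a b V) ∧
    causalStructure (tensorU3 a b V) = G ∧
    ¬ ∃ C : QuantumCircuit (WithQubits a HA) (WithQubits b HB),
      C.IsUnitary ∧ C.connectivity = G ∧ C.IsDecompositionOf (tensorU3 a b V) := by
  obtain ⟨v, h₁, h₂, rfl⟩ := hV.exists_conjBy
  subst hGV
  refine ⟨?_, causalStructure_tensorU3 v hG, not_exists_unitary_circuit hG v⟩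
  rw [tensorU3_conjBy]
  exact isUnitaryChannel_conjBy (tensorMatrix_conjTranspose_mul a b h₁)
    (tensorMatrix_mul_conjTranspose a b h₂)
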